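/- Let $\rho\ge 0$ be a weight function on $\mathbb{R}_+=(0,\infty)$ that is not almost everywhere zero, and let $I\subseteq\mathbb{R}$ be an open set such that $\int_0^\infty x^i e^{tx}\rho(x)\,dx$ converges absolutely for all $t\in I$ and all integers $i\ge 0$. For $t\in I$ and integers $i,j\ge 0$ put $$\beta_i(t)=\int_{\mathbb{R}_+}x^i e^{tx}\rho(x)\,dx,\qquad \mu_{i,j}(t)=\iint_{\mathbb{R}_+^2}x^iy^j\,\frac{x-y}{x+y}\,e^{t(x+y)}\rho(x)\rho(y)\,dx\,dy ,$$ where the double integral converges absolutely. For a list $a_1,\dots,a_{2N}$ of labels from $\{d_0,d_1,0,1,2,\dots\}$ let $\mathrm{Pf}(a_1,\dots,a_{2N})$ be the Pfaffian of the skew-symmetric matrix with entries $\mathrm{Pf}(a_k,a_l)$, where $$\mathrm{Pf}(i,j)=\mu_{i,j},\qquad \mathrm{Pf}(d_0,i)=\beta_i,\qquad \mathrm{Pf}(d_1,i)=\beta_{i+1},\qquad \mathrm{Pf}(d_0,d_1)=0,$$ and the Pfaffian of order $0$ is $1$. Define $$\tau_{2n}(t)=\mathrm{Pf}(0,1,\dots,2n-1),\qquad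 \tau_{2n+1}(t)=\mathrm{Pf}(d_0,0,1,\dots,2n)\qquad (n\ge 0).$$ Then the following hold on $I$. 1. For all $i,j\ge0$, the entries are differentiable and satisfy $$\frac{d}{dt}\mathrm{Pf}(d_0,i)=\mathrm{Pf}(d_0,i+1)=\mathrm{Pf}(d_1,i),\qquad \frac{d}{dt}\mathrm{Pf}(i,j)=\mathrm{Pf}(i+1,j)+\mathrm{Pf}(i,j+1)=\mathrm{Pf}(d_0,d_1,i,j).$$ 2. Every $\tau_n$ is twice differentiable and has no zero in $I$. 3. For all $n\ge 1$, $$\tau_n''\,\tau_n-(\tau_n')^2=\tau_{n-1}'\,\tau_{n+1}-\tau_{n+1}'\,\tau_{n-1}.$$ 4. The functions $$u_n=\frac{\tau_{n+1}\tau_{n-1}}{\tau_n^2}\quad(n\ge 1),\qquad b_n=\frac{d}{dt}\log|\tau_n|=\frac{\tau_n'}{\tau_n}\quad (n\ge 0)$$ are differentiable for $n\ge1$ and solve the 1+1 dimensional Toda lattice of BKP type $$\frac{d}{dt}u_n=u_n\,(b_{n+1}-2b_n+b_{n-1}),\qquad \frac{d}{dt}b_n=u_n\,(b_{n-1}-b_{n+1}),\qquad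 n=1,2,\dots .$$ -/

import Mathlib

open MeasureTheory Set

noncomputable section

namespace BToda

/-- The Pfaffian of a skew-symmetric real matrix of order `2 * n`, with rows and columns numbered
from `0`. Each splitting of the indices into `n` pairs is produced by `2 ^ n * n !` permutations,
which all contribute the same signed product because `A` is skew-symmetric. So this is the sum of
the signed products over all perfect matchings. The Pfaffian of order `0` is `1`. -/
def pfaffian {n : ℕ} (A : Matrix (Fin (2 * n)) (Fin (2 * n)) ℝ) : ℝ :=
  (∑ σ : Equiv.Perm (Fin (2 * n)), ((Equiv.Perm.sign σ : ℤ) : ℝ) *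
    ∏ l : Fin n, A (σ ⟨2 * (l : ℕ), by omega⟩) (σ ⟨2 * (l : ℕ) + 1, by omega⟩)) /
  (2 ^ n * (n.factorial : ℝ))

/-- The moments `β_i(t) = ∫_{ℝ₊} x^i e^{tx} ρ(x) dx`. -/
def beta (ρ : ℝ → ℝ) (i : ℕ) (t : ℝ) : ℝ :=
  ∫ x in Ioi (0 : ℝ), x ^ i * Real.exp (t * x) * ρ x

/-- The integrand of the bimoment `μ_{i,j}(t)`. -/
def muIntegrand (ρ : ℝ → ℝ) (i j : ℕ) (t : ℝ) (p : ℝ × ℝ) : ℝ :=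
  p.1 ^ i * p.2 ^ j * ((p.1 - p.2) / (p.1 + p.2)) * Real.exp (t * (p.1 + p.2)) * ρ p.1 * ρ p.2

/-- The bimoments
`μ_{i,j}(t) = ∬_{ℝ₊²} x^i y^j (x - y)/(x + y) e^{t(x + y)} ρ(x) ρ(y) dx dy`. -/
def mu (ρ : ℝ → ℝ) (i j : ℕ) (t : ℝ) : ℝ :=
  ∫ p in Ioi (0 : ℝ) ×ˢ Ioi (0 : ℝ), muIntegrand ρ i j t p

/-- The characters that label the rows and columns: `d₀`, `d₁` and the numbers `0, 1, 2, …`. -/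
inductive Label where
  | d0 : Label
  | d1 : Label
  | num : ℕ → Label

/-- The (skew-symmetric) Pfaffian entries `Pf(a, b)` at time `t`: `Pf(i, j) = μ_{i,j}`,
`Pf(d₀, i) = β_i`, `Pf(d₁, i) = β_{i+1}`, `Pf(d₀, d₁) = 0`. -/
def entry (ρ : ℝ → ℝ) (t : ℝ) : Label → Label → ℝ
  | .num i, .num j => mu ρ i j t
  | .d0, .num i => beta ρ i t
  | .num i, .d0 => -beta ρ i t
  | .d1, .num i => beta ρ (i + 1) t
  | .num i, .d1 => -beta ρ (i + 1) t
  | .d0, .d0 => 0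
  | .d0, .d1 => 0
  | .d1, .d0 => 0
  | .d1, .d1 => 0

/-- The Pfaffian `Pf(a₁, …, a_{2n})` of a list of labels. -/
def Pf (ρ : ℝ → ℝ) (t : ℝ) {n : ℕ} (a : Fin (2 * n) → Label) : ℝ :=
  pfaffian (Matrix.of fun i j => entry ρ t (a i) (a j))

/-- The list `0, 1, …, 2n - 1`. -/
def evenLabels (n : ℕ) : Fin (2 * n) → Label := fun i => .num i

/-- The list `d₀, 0, 1, …, 2n`. -/
def oddLabels (n : ℕ) : Fin (2 * (n + 1)) → Label := fun i =>
  if (i : ℕ) = 0 then .d0 else .num ((i : ℕ) - 1)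

/-- The tau-functions `τ_{2n} = Pf(0, …, 2n - 1)` and `τ_{2n+1} = Pf(d₀, 0, …, 2n)`. -/
def tau (ρ : ℝ → ℝ) (n : ℕ) (t : ℝ) : ℝ :=
  if Even n then Pf ρ t (evenLabels (n / 2)) else Pf ρ t (oddLabels (n / 2))

/-- `u_n = τ_{n+1} τ_{n-1} / τ_n²` for `n ≥ 1`, with the boundary value `u_0 = 0`. -/
def u (ρ : ℝ → ℝ) : ℕ → ℝ → ℝ
  | 0, _ => 0
  | n + 1, t => tau ρ (n + 2) t * tau ρ n t / tau ρ (n + 1) t ^ 2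

/-- `b_n = d/dt log τ_n`, where `Real.log x = log |x|` takes care of the sign of `τ_n`. -/
def b (ρ : ℝ → ℝ) (n : ℕ) (t : ℝ) : ℝ :=
  deriv (fun s => Real.log (tau ρ n s)) t

end BToda

end

/-! Bilinear equation. Multiplying the kernel `(x - y)/(x + y)` by `x + y` removes the denominator,
so the derivative of `μ_{i,j}` splits as `β_{i+1} β_j - β_i β_{j+1} = Pf(d₀, d₁, i, j)`. Induction
along the row expansion then gives `Pf(v)' = Pf(d₀, d₁, v)` and `Pf(d₀, v)' = Pf(d₁, v)` for
numerical `v` (`hasDerivAt_pf_nums`, `hasDerivAt_pf_d0_nums`). The product rule gives the same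
derivatives as sums over raising one label by 1; for consecutive labels only the raising of the last
one survives (`hasDerivAt_pf_init`, `hasDerivAt_pf_d0_init`). With the two forms combined, `τ_n`,
`τ_n'`, `τ_n''` and the neighbouring tau-functions are all Pfaffians over one common list extended
by some of four labels. The bilinear equation is then a Plücker relation, a case of Ohta's identity
`sum_pf_mul_pf`.

Nonvanishing. This is de Bruijn's integration formula. Written as a sum over permutations, `τ_m` is
up to a positive factor the integral of a Vandermonde product times a product of kernels over pairs,
against the weight `w(x) = e^{tx} ρ(x)`. Symmetrising and applying Schur's Pfaffian
(`pf_schurKernel`, and `sum_pf_schurKernel_removeNth` for odd `m`) turns the integrand into a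
nonzero multiple of `∏_{i<j} (x_j - x_i)(x_i - x_j)/(x_i + x_j) · ∏ w(x_k)`. It has constant sign
and is zero off the diagonals only where some `w(x_k)` is, so its integral is not zero
(`sum_sign_mul_moment_ne_zero`).

Toda lattice. The equation for `u_n` is logarithmic differentiation; the one for `b_n` is the
bilinear equation divided by `τ_n²`. -/

namespace BToda

/-! ### Pfaffians: from the sum over permutations to expansion along the first row. -/

variable {L : Type*}

/-- Permutations are sorted by their value `j` at `0`; the rest is a permutation `e` of the
remaining indices, and the cycle bringing `j` to the front has sign `(-1)^j`. -/
theorem sum_perm_eq_sum_cons {m : ℕ} (G : (Fin (m + 1) → Fin (m + 1)) → ℝ) :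
    ∑ σ : Equiv.Perm (Fin (m + 1)), ((Equiv.Perm.sign σ : ℤ) : ℝ) * G σ =
      ∑ j : Fin (m + 1), (-1) ^ (j : ℕ) * ∑ e : Equiv.Perm (Fin m),
        ((Equiv.Perm.sign e : ℤ) : ℝ) * G (Fin.cons j fun i => j.succAbove (e i)) := by
  let Φ : Fin (m + 1) × Equiv.Perm (Fin m) → Equiv.Perm (Fin (m + 1)) := fun q =>
    (q.1.cycleRange)⁻¹ * Equiv.Perm.decomposeFin.symm (0, q.2)
  have h0 : ∀ q, Φ q 0 = q.1 := fun q => by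
    simp [Φ, Equiv.Perm.inv_def]
  have hs : ∀ q i, Φ q (Fin.succ i) = q.1.succAbove (q.2 i) := fun q i => by
    simp [Φ, Equiv.Perm.inv_def]
  have hinj : Function.Injective Φ := by
    rintro ⟨j, e⟩ ⟨j', e'⟩ h
    have hj : j = j' := (h0 (j, e)).symm.trans ((congrArg (fun τ => τ 0) h).trans (h0 (j', e')))
    subst hj
    congr 1
    ext i
    have := hs (j, e) i
    rw [h, hs] at this
    rw [Fin.succAbove_right_injective this]
  have hbij : Function.Bijective Φ :=
    (Fintype.bijective_iff_injective_and_card Φ).2 ⟨hinj, by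
      simp [Fintype.card_perm, Nat.factorial_succ]⟩
  rw [← hbij.sum_comp, Fintype.sum_prod_type]
  refine Finset.sum_congr rfl fun j _ => ?_
  rw [Finset.mul_sum]
  refine Finset.sum_congr rfl fun e _ => ?_
  have hc : (⇑(Φ (j, e)) : Fin (m + 1) → Fin (m + 1)) =
      Fin.cons j fun i => j.succAbove (e i) := by
    funext i
    refine Fin.cases ?_ (fun i => ?_) i
    · simp [h0]
    · simp [hs]
  rw [hc]
  simp [Φ, Fin.sign_cycleRange, mul_assoc]

/-- The product `∏ A(v_{2l}, v_{2l+1})` along the standard perfect matching. -/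
def pairProd (A : L → L → ℝ) (n : ℕ) (v : Fin (2 * n) → L) : ℝ :=
  ∏ l : Fin n, A (v ⟨2 * (l : ℕ), by omega⟩) (v ⟨2 * (l : ℕ) + 1, by omega⟩)

/-- The signed sum of the products `pairProd` over all orderings of `v`. -/
def pairSum (A : L → L → ℝ) (n : ℕ) (v : Fin (2 * n) → L) : ℝ :=
  ∑ σ : Equiv.Perm (Fin (2 * n)), ((Equiv.Perm.sign σ : ℤ) : ℝ) * pairProd A n (v ∘ σ)

theorem pairProd_succ (A : L → L → ℝ) (n : ℕ) (v : Fin (2 * n + 1 + 1) → L) :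
    pairProd A (n + 1) v = A (v 0) (v 1) * pairProd A n (fun i => v i.succ.succ) := by
  unfold pairProd
  rw [Fin.prod_univ_succ]
  rfl

theorem pairProd_comp_swap_zero_one {A : L → L → ℝ} (hA : ∀ x y, A x y = -A y x) (n : ℕ)
    (v : Fin (2 * n + 1 + 1) → L) :
    pairProd A (n + 1) (v ∘ Equiv.swap 0 1) = -pairProd A (n + 1) v := by
  rw [pairProd_succ, pairProd_succ]
  have h : ∀ i : Fin (2 * n), Equiv.swap (0 : Fin (2 * n + 1 + 1)) 1 i.succ.succ = i.succ.succ :=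
    fun i => Equiv.swap_apply_of_ne_of_ne (by simp) (by simp [Fin.ext_iff])
  simp only [Function.comp_apply, Equiv.swap_apply_left, Equiv.swap_apply_right, h]
  rw [hA]
  ring

theorem pairProd_comp_swap_pair (A : L → L → ℝ) (n : ℕ) (l : Fin (n + 1))
    (v : Fin (2 * (n + 1)) → L) :
    pairProd A (n + 1) (v ∘ (Equiv.swap ⟨0, by omega⟩ ⟨2 * (l : ℕ), by omega⟩ *
      Equiv.swap ⟨1, by omega⟩ ⟨2 * (l : ℕ) + 1, by omega⟩ : Equiv.Perm _)) =
      pairProd A (n + 1) v := by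
  unfold pairProd
  refine (Equiv.prod_comp (Equiv.swap (0 : Fin (n + 1)) l) _).symm.trans ?_ |>.symm
  refine Finset.prod_congr rfl fun k _ => ?_
  have key : ∀ (c : ℕ) (hc : c < 2), (Equiv.swap (⟨0, by omega⟩ : Fin (2 * (n + 1)))
      ⟨2 * (l : ℕ), by omega⟩ * Equiv.swap ⟨1, by omega⟩ ⟨2 * (l : ℕ) + 1, by omega⟩ :
        Equiv.Perm _) ⟨2 * (k : ℕ) + c, by omega⟩ =
      ⟨2 * ((Equiv.swap (0 : Fin (n + 1)) l k : Fin (n + 1)) : ℕ) + c, by omega⟩ := by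
    intro c hc
    simp only [Equiv.Perm.mul_apply, Equiv.swap_apply_def, Fin.ext_iff]
    interval_cases c <;> split_ifs <;> simp_all <;> omega
  have k0 := key 0 (by omega)
  have k1 := key 1 (by omega)
  simp only [add_zero] at k0
  simp only [Function.comp_apply]
  rw [k0, k1]

theorem swap_mul_swap_apply {α : Type*} [DecidableEq α] {a c d : α} (b : α) (hc : a ≠ c)
    (hd : a ≠ d) : (Equiv.swap a b * Equiv.swap c d) a = b := by
  rw [Equiv.Perm.mul_apply, Equiv.swap_apply_of_ne_of_ne hc hd, Equiv.swap_apply_left]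

/-- Permuting the pairs, or swapping inside a pair, leaves each signed product unchanged. Hence the
permutations sending position `k` to `0` contribute the same for all `2n + 2` positions `k`. -/
theorem pairSum_succ_eq {A : L → L → ℝ} (hA : ∀ x y, A x y = -A y x) (n : ℕ)
    (v : Fin (2 * n + 1 + 1) → L) :
    pairSum A (n + 1) v = (2 * n + 2) *
      ∑ σ : Equiv.Perm (Fin (2 * n + 1 + 1)), if σ 0 = 0 then
        ((Equiv.Perm.sign σ : ℤ) : ℝ) * pairProd A (n + 1) (v ∘ σ) else 0 := by
  let f : Equiv.Perm (Fin (2 * n + 1 + 1)) → ℝ := fun σ =>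
    ((Equiv.Perm.sign σ : ℤ) : ℝ) * pairProd A (n + 1) (v ∘ σ)
  have hpair : ∀ (l : Fin (n + 1)) (σ : Equiv.Perm (Fin (2 * n + 1 + 1))),
      f (σ * (Equiv.swap (⟨0, by omega⟩ : Fin (2 * n + 1 + 1)) ⟨2 * (l : ℕ), by omega⟩ *
        Equiv.swap ⟨1, by omega⟩ ⟨2 * (l : ℕ) + 1, by omega⟩)) = f σ := by
    intro l σ
    have h := pairProd_comp_swap_pair A n l (v ∘ σ)
    simp only [f, Equiv.Perm.coe_mul, ← Function.comp_assoc] at h ⊢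
    rw [h]
    congr 2
    rcases eq_or_ne (l : ℕ) 0 with h0 | h0
    · simp [h0]
    · rw [Equiv.Perm.sign_mul, Equiv.Perm.sign_mul, Equiv.Perm.sign_swap, Equiv.Perm.sign_swap]
      · simp
      · exact fun h => by have := congrArg Fin.val h; dsimp only at this; omega
      · exact fun h => by have := congrArg Fin.val h; dsimp only at this; omega
  have hsw : ∀ σ : Equiv.Perm (Fin (2 * n + 1 + 1)), f (σ * Equiv.swap 0 1) = f σ := by
    intro σ
    have h := pairProd_comp_swap_zero_one hA n (v ∘ σ)
    simp only [f, Equiv.Perm.coe_mul, ← Function.comp_assoc] at h ⊢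
    rw [h, Equiv.Perm.sign_mul, Equiv.Perm.sign_swap (by simp)]
    simp
  -- An even `k = 2l` is reached from `0` by exchanging pair `0` with pair `l`; an odd `k = 2l + 1`
  -- needs in addition the swap inside the first pair.
  have hτ : ∀ k : Fin (2 * n + 1 + 1), ∃ τ : Equiv.Perm (Fin (2 * n + 1 + 1)),
      τ 0 = k ∧ ∀ σ, f (σ * τ) = f σ := by
    intro k
    rcases Nat.even_or_odd' (k : ℕ) with ⟨l, hl | hl⟩
    · refine ⟨_, ?_, hpair ⟨l, by omega⟩⟩
      refine (swap_mul_swap_apply _ ?_ ?_).trans (Fin.ext hl.symm)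
      · exact fun h => by have := congrArg Fin.val h; simp at this
      · exact fun h => by have := congrArg Fin.val h; simp at this
    · refine ⟨(Equiv.swap (⟨0, by omega⟩ : Fin (2 * n + 1 + 1)) ⟨2 * l, by omega⟩ *
        Equiv.swap ⟨1, by omega⟩ ⟨2 * l + 1, by omega⟩) * Equiv.swap 0 1, ?_, fun σ => ?_⟩
      · have h1 : (1 : Fin (2 * n + 1 + 1)) = ⟨1, by omega⟩ := rfl
        rw [Equiv.Perm.mul_apply, Equiv.swap_apply_left, Equiv.Perm.mul_apply, h1,
          Equiv.swap_apply_left, Equiv.swap_apply_of_ne_of_ne]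
        · exact Fin.ext hl.symm
        · exact fun h => by have := congrArg Fin.val h; simp at this
        · exact fun h => by have := congrArg Fin.val h; simp at this
      · rw [← mul_assoc, hsw, hpair ⟨l, by omega⟩]
  have h1 : ∀ k : Fin (2 * n + 1 + 1), (∑ σ, if σ k = 0 then f σ else 0) =
      ∑ σ : Equiv.Perm (Fin (2 * n + 1 + 1)), if σ 0 = 0 then f σ else 0 := by
    intro k
    obtain ⟨τ, hk, hf⟩ := hτ k
    rw [← Equiv.sum_comp (Equiv.mulRight τ)
      fun σ : Equiv.Perm (Fin (2 * n + 1 + 1)) => if σ 0 = 0 then f σ else 0]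
    refine Finset.sum_congr rfl fun σ _ => ?_
    simp [hk, hf]
  have h2 : pairSum A (n + 1) v = ∑ σ : Equiv.Perm (Fin (2 * n + 1 + 1)),
      ∑ k, if σ k = 0 then f σ else 0 := by
    refine Finset.sum_congr rfl fun (σ : Equiv.Perm (Fin (2 * n + 1 + 1))) _ => ?_
    change f σ = ∑ k : Fin (2 * n + 1 + 1), if σ k = 0 then f σ else 0
    rw [Finset.sum_eq_single (σ⁻¹ 0)]
    · simp
    · intro k _ hk
      rw [if_neg]
      rintro h
      exact hk (by simp [← h])
    · simp
  rw [h2, Finset.sum_comm, Finset.sum_congr rfl fun k _ => h1 k, Finset.sum_const]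
  simp only [Finset.card_univ, Fintype.card_fin, nsmul_eq_mul]
  push_cast
  ring

theorem pairSum_succ {A : L → L → ℝ} (hA : ∀ x y, A x y = -A y x) (n : ℕ)
    (v : Fin (2 * n + 1 + 1) → L) :
    pairSum A (n + 1) v = (2 * n + 2) * ∑ j : Fin (2 * n + 1), (-1) ^ (j : ℕ) *
      A (v 0) (v j.succ) * pairSum A n (fun i => v (j.succAbove i).succ) := by
  rw [pairSum_succ_eq hA]
  congr 1
  have := sum_perm_eq_sum_cons (m := 2 * n + 1) (fun s => if s 0 = 0 then
    pairProd A (n + 1) (v ∘ s) else 0)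
  simp only [mul_ite, mul_zero, Fin.cons_zero] at this
  rw [this, Fin.sum_univ_succ]
  simp only [Fin.val_zero, pow_zero, one_mul, if_true, Fin.succ_ne_zero, if_false,
    Finset.sum_const_zero, mul_zero, add_zero]
  have h := sum_perm_eq_sum_cons (m := 2 * n) (fun s =>
    A (v 0) (v (s 0).succ) * pairProd A n (fun i => v (s i.succ).succ))
  simp only [Fin.cons_zero, Fin.cons_succ] at h
  refine Eq.trans ?_ (h.trans ?_)
  · refine Finset.sum_congr rfl fun e _ => ?_
    congr 1
    exact pairProd_succ _ _ _
  · refine Finset.sum_congr rfl fun j _ => ?_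
    rw [mul_assoc]
    congr 1
    rw [pairSum, Finset.mul_sum]
    refine Finset.sum_congr rfl fun e _ => ?_
    simp only [Function.comp_def]
    ring

/-- The Pfaffian of the array `A(v_i, v_j)`, by expansion along the first row. It vanishes for
odd orders. -/
def pf (A : L → L → ℝ) : (m : ℕ) → (Fin m → L) → ℝ
  | 0, _ => 1
  | 1, _ => 0
  | m + 2, v => ∑ j : Fin (m + 1), (-1) ^ (j : ℕ) * A (v 0) (v j.succ) *
      pf A m (j.removeNth (Fin.tail v))

/-- Links the two descriptions: antisymmetry under reordering is read off the permutation sum,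
derivatives off the row expansion. -/
theorem pairSum_eq_pf {A : L → L → ℝ} (hA : ∀ x y, A x y = -A y x) (n : ℕ)
    (v : Fin (2 * n) → L) : pairSum A n v = 2 ^ n * (n.factorial : ℝ) * pf A (2 * n) v := by
  induction n with
  | zero => simp [pairSum, pairProd, pf]
  | succ n ih =>
    rw [pairSum_succ hA]
    simp only [ih]
    change _ = _ * pf A (2 * n + 2) v
    rw [pf, Finset.mul_sum, Finset.mul_sum]
    refine Finset.sum_congr rfl fun j _ => ?_
    rw [Nat.factorial_succ]
    push_cast
    have : (fun i => v (j.succAbove i).succ) = j.removeNth (Fin.tail v) := rfl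
    rw [this]
    ring

theorem pfaffian_eq_pf {A : L → L → ℝ} (hA : ∀ x y, A x y = -A y x) (n : ℕ)
    (v : Fin (2 * n) → L) :
    pfaffian (Matrix.of fun i j => A (v i) (v j)) = pf A (2 * n) v := by
  have h : pfaffian (Matrix.of fun i j => A (v i) (v j)) =
    pairSum A n v / (2 ^ n * (n.factorial : ℝ)) := rfl
  rw [h, pairSum_eq_pf hA, mul_div_cancel_left₀]
  positivity

theorem pf_cons (A : L → L → ℝ) (m : ℕ) (a : L) (w : Fin (m + 1) → L) :
    pf A (m + 2) (Fin.cons a w) =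
      ∑ j : Fin (m + 1), (-1) ^ (j : ℕ) * A a (w j) * pf A m (j.removeNth w) := by
  simp [pf]

theorem pf_odd (A : L → L → ℝ) (n : ℕ) (v : Fin (2 * n + 1) → L) : pf A (2 * n + 1) v = 0 := by
  induction n with
  | zero => rfl
  | succ n ih =>
    change pf A (2 * n + 1 + 2) v = 0
    rw [pf]
    simp [ih]

theorem pf_comp_perm {A : L → L → ℝ} (hA : ∀ x y, A x y = -A y x) (m : ℕ) (v : Fin m → L)
    (σ : Equiv.Perm (Fin m)) :
    pf A m (v ∘ σ) = ((Equiv.Perm.sign σ : ℤ) : ℝ) * pf A m v := by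
  rcases Nat.even_or_odd' m with ⟨n, rfl | rfl⟩
  · have key : pairSum A n (v ∘ σ) = ((Equiv.Perm.sign σ : ℤ) : ℝ) * pairSum A n v := by
      rw [pairSum, pairSum, Finset.mul_sum, ← Equiv.sum_comp (Equiv.mulLeft σ⁻¹)]
      refine Finset.sum_congr rfl fun τ _ => ?_
      simp only [Equiv.coe_mulLeft, Equiv.Perm.sign_mul, Equiv.Perm.sign_inv, Function.comp_assoc]
      rw [← Equiv.Perm.coe_mul, mul_inv_cancel_left]
      push_cast
      ring
    rw [pairSum_eq_pf hA, pairSum_eq_pf hA] at key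
    have : (2 ^ n * (n.factorial : ℝ)) ≠ 0 := by positivity
    apply mul_left_cancel₀ this
    rw [key]
    ring
  · simp [pf_odd]

theorem pf_eq_zero_of_eq {A : L → L → ℝ} (hA : ∀ x y, A x y = -A y x) (m : ℕ) (v : Fin m → L)
    {i j : Fin m} (hij : i ≠ j) (h : v i = v j) : pf A m v = 0 := by
  have h1 : v ∘ Equiv.swap i j = v := by
    funext k
    simp only [Function.comp_apply, Equiv.swap_apply_def]
    split_ifs with h2 h3
    · rw [h2, h]
    · rw [h3, h]
    · rfl
  have := pf_comp_perm hA m v (Equiv.swap i j)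
  rw [h1, Equiv.Perm.sign_swap hij] at this
  push_cast at this
  linarith

end BToda

/-! ### Reordering labels, Ohta's identity and the Plücker relations. -/

namespace BToda

variable {L : Type*}

theorem removeNth_succ_cons {m : ℕ} (i : Fin (m + 1)) (a : L) (w : Fin (m + 1) → L) :
    i.succ.removeNth (Fin.cons a w : Fin (m + 2) → L) =
      (Fin.cons a (i.removeNth w) : Fin (m + 1) → L) := by
  funext k
  refine Fin.cases ?_ (fun k => ?_) k
  · simp [Fin.removeNth]
  · simp [Fin.removeNth]

theorem removeNth_zero_cons {m : ℕ} (a : L) (w : Fin m → L) :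
    (0 : Fin (m + 1)).removeNth (Fin.cons a w : Fin (m + 1) → L) = w := by
  funext k
  simp [Fin.removeNth]

theorem pf_cons_eq_zero {A : L → L → ℝ} (hA : ∀ x y, A x y = -A y x) {m : ℕ} (w : Fin m → L)
    (i : Fin m) : pf A (m + 1) (Fin.cons (w i) w) = 0 :=
  pf_eq_zero_of_eq hA _ _ (Fin.succ_ne_zero i).symm (by simp)

theorem pf_cons_cons_eq_zero {A : L → L → ℝ} (hA : ∀ x y, A x y = -A y x) {m : ℕ} (a : L)
    (w : Fin m → L) (i : Fin m) : pf A (m + 2) (Fin.cons (w i) (Fin.cons a w)) = 0 := by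
  have := pf_cons_eq_zero hA (Fin.cons a w : Fin (m + 1) → L) i.succ
  simpa using this

theorem pf_swap {A : L → L → ℝ} (hA : ∀ x y, A x y = -A y x) {m : ℕ} (a b : L) (w : Fin m → L) :
    pf A (m + 2) (Fin.cons a (Fin.cons b w)) = -pf A (m + 2) (Fin.cons b (Fin.cons a w)) := by
  have h := pf_comp_perm hA _ (Fin.cons b (Fin.cons a w) : Fin (m + 2) → L) (Equiv.swap 0 1)
  have h2 : (Fin.cons b (Fin.cons a w) : Fin (m + 2) → L) ∘ Equiv.swap 0 1 =
      Fin.cons a (Fin.cons b w) := by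
    funext k
    refine Fin.cases ?_ (fun k => ?_) k
    · simp
    · refine Fin.cases ?_ (fun k => ?_) k
      · simp
      · rw [Function.comp_apply,
          Equiv.swap_apply_of_ne_of_ne (by simp) (by simp [Fin.ext_iff])]
        simp
  rw [← h2, h, Equiv.Perm.sign_swap (by simp)]
  simp

theorem pf_cons_swap {A : L → L → ℝ} (hA : ∀ x y, A x y = -A y x) {m : ℕ} (a b c : L)
    (w : Fin m → L) : pf A (m + 3) (Fin.cons a (Fin.cons b (Fin.cons c w))) =
      -pf A (m + 3) (Fin.cons a (Fin.cons c (Fin.cons b w))) := by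
  have h := pf_comp_perm hA _ (Fin.cons a (Fin.cons c (Fin.cons b w)) : Fin (m + 3) → L)
    (Equiv.swap (Fin.succ 0) (Fin.succ (Fin.succ 0)))
  have h2 : (Fin.cons a (Fin.cons c (Fin.cons b w)) : Fin (m + 3) → L) ∘
      Equiv.swap (Fin.succ 0) (Fin.succ (Fin.succ 0)) =
      Fin.cons a (Fin.cons b (Fin.cons c w)) := by
    funext k
    rw [Function.comp_apply]
    refine Fin.cases ?_ (fun k => ?_) k
    · rw [Equiv.swap_apply_of_ne_of_ne (Fin.succ_ne_zero _).symm (Fin.succ_ne_zero _).symm]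
      simp
    · refine Fin.cases ?_ (fun k => ?_) k
      · rw [Equiv.swap_apply_left]
        simp only [Fin.cons_succ, Fin.cons_zero]
      · refine Fin.cases ?_ (fun k => ?_) k
        · rw [Equiv.swap_apply_right]
          simp only [Fin.cons_succ, Fin.cons_zero]
        · rw [Equiv.swap_apply_of_ne_of_ne
            (fun h => Fin.succ_ne_zero _ (Fin.succ_injective _ h))
            (fun h => Fin.succ_ne_zero _ (Fin.succ_injective _ (Fin.succ_injective _ h)))]
          simp only [Fin.cons_succ]
  rw [← h2, h, Equiv.Perm.sign_swap (fun h => Fin.succ_ne_zero _ (Fin.succ_injective _ h).symm)]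
  simp

/-- The lists `0, 1, …` grow at the end, the Plücker relations work at the front. This lemma and its
variants below carry the signs of the passage. -/
theorem pf_snoc {A : L → L → ℝ} (hA : ∀ x y, A x y = -A y x) {m : ℕ} (w : Fin m → L) (a : L) :
    pf A (m + 1) (Fin.snoc w a : Fin (m + 1) → L) = (-1) ^ m * pf A (m + 1) (Fin.cons a w) := by
  rw [Fin.snoc_eq_cons_rotate]
  have := pf_comp_perm hA _ (Fin.cons a w : Fin (m + 1) → L) (finRotate (m + 1))
  rw [sign_finRotate] at this
  simpa only [add_tsub_cancel_right, Units.val_pow_eq_pow_val, Units.val_neg, Units.val_one,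
    Int.cast_pow, Int.cast_neg, Int.cast_one, Function.comp_def] using this

theorem cons_snoc {m : ℕ} (a b : L) (w : Fin m → L) :
    (Fin.cons a (Fin.snoc w b : Fin (m + 1) → L) : Fin (m + 2) → L) =
      (Fin.snoc (Fin.cons a w : Fin (m + 1) → L) b : Fin (m + 2) → L) := by
  funext k
  refine Fin.lastCases ?_ (fun k => ?_) k
  · rw [Fin.snoc_last, ← Fin.succ_last, Fin.cons_succ, Fin.snoc_last]
  · rw [Fin.snoc_castSucc]
    refine Fin.cases ?_ (fun k => ?_) k
    · simp
    · rw [← Fin.succ_castSucc, Fin.cons_succ, Fin.snoc_castSucc, Fin.cons_succ]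

theorem pf_cons_snoc {A : L → L → ℝ} (hA : ∀ x y, A x y = -A y x) {m : ℕ} (a : L)
    (w : Fin m → L) (b : L) :
    pf A (m + 2) (Fin.cons a (Fin.snoc w b : Fin (m + 1) → L)) =
      (-1) ^ m * pf A (m + 2) (Fin.cons a (Fin.cons b w)) := by
  rw [cons_snoc, pf_snoc hA, pf_swap hA]
  ring

theorem pf_cons_cons_snoc {A : L → L → ℝ} (hA : ∀ x y, A x y = -A y x) {m : ℕ} (a b : L)
    (w : Fin m → L) (c : L) :
    pf A (m + 3) (Fin.cons a (Fin.cons b (Fin.snoc w c : Fin (m + 1) → L))) =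
      (-1) ^ m * pf A (m + 3) (Fin.cons a (Fin.cons b (Fin.cons c w))) := by
  rw [cons_snoc, pf_cons_snoc hA, pf_cons_swap hA]
  ring

theorem pf_snoc_snoc {A : L → L → ℝ} (hA : ∀ x y, A x y = -A y x) {m : ℕ}
    (w : Fin m → L) (a b : L) :
    pf A (m + 2) (Fin.snoc (Fin.snoc w a : Fin (m + 1) → L) b : Fin (m + 2) → L) =
      pf A (m + 2) (Fin.cons a (Fin.cons b w)) := by
  rw [pf_snoc hA, pf_cons_snoc hA, pf_swap hA]
  rcases neg_one_pow_eq_or ℝ m with h | h <;> simp [pow_succ, h]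

theorem pf_cons_snoc_snoc {A : L → L → ℝ} (hA : ∀ x y, A x y = -A y x) {m : ℕ} (x : L)
    (w : Fin m → L) (a b : L) :
    pf A (m + 1 + 2) (Fin.cons x (Fin.snoc (Fin.snoc w a : Fin (m + 1) → L) b : Fin (m + 2) → L)) =
      pf A (m + 3) (Fin.cons x (Fin.cons a (Fin.cons b w))) := by
  rw [pf_cons_snoc hA, cons_snoc, pf_cons_snoc hA, ← mul_assoc, ← mul_pow]
  simp

theorem pf_cons_cons_snoc_snoc {A : L → L → ℝ} (hA : ∀ x y, A x y = -A y x) {m : ℕ} (x y : L)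
    (w : Fin m → L) (a b : L) :
    pf A (m + 1 + 3) (Fin.cons x (Fin.cons y
      (Fin.snoc (Fin.snoc w a : Fin (m + 1) → L) b : Fin (m + 2) → L))) =
      pf A (m + 4) (Fin.cons x (Fin.cons y (Fin.cons a (Fin.cons b w)))) := by
  rw [pf_cons_cons_snoc hA, cons_snoc, pf_cons_cons_snoc hA, ← mul_assoc, ← mul_pow]
  simp

/-- Ohta's quadratic identity for Pfaffians. -/
theorem sum_pf_mul_pf {A : L → L → ℝ} (hA : ∀ x y, A x y = -A y x) {m k : ℕ}
    (w : Fin (m + 1) → L) (z : Fin (k + 1) → L) :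
    ∑ i : Fin (m + 1), (-1) ^ (i : ℕ) * pf A m (i.removeNth w) * pf A (k + 2) (Fin.cons (w i) z) =
      -∑ j : Fin (k + 1), (-1) ^ (j : ℕ) * pf A (m + 2) (Fin.cons (z j) w) *
        pf A k (j.removeNth z) := by
  -- Expanding along the added label makes both sides the same double sum over `i`, `j`, except that
  -- `A (w i) (z j)` is replaced by `A (z j) (w i)`.
  simp only [pf_cons, Finset.mul_sum, Finset.sum_mul]
  rw [Finset.sum_comm, ← Finset.sum_neg_distrib]
  refine Finset.sum_congr rfl fun j _ => ?_
  rw [← Finset.sum_neg_distrib]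
  refine Finset.sum_congr rfl fun i _ => ?_
  rw [hA (w i) (z j)]
  ring

/-- Ohta's identity for the lists `(b, c, d, w)` and `(a, w)`: each term that transfers a label of
`w` has a repeated label and vanishes. -/
theorem pf_plucker_even {A : L → L → ℝ} (hA : ∀ x y, A x y = -A y x) {k : ℕ} (a b c d : L)
    (w : Fin k → L) :
    pf A (k + 2) (Fin.cons c (Fin.cons d w)) * pf A (k + 2) (Fin.cons b (Fin.cons a w)) -
      pf A (k + 2) (Fin.cons b (Fin.cons d w)) * pf A (k + 2) (Fin.cons c (Fin.cons a w)) +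
      pf A (k + 2) (Fin.cons b (Fin.cons c w)) * pf A (k + 2) (Fin.cons d (Fin.cons a w)) =
      -(pf A (k + 4) (Fin.cons a (Fin.cons b (Fin.cons c (Fin.cons d w)))) * pf A k w) := by
  have h := sum_pf_mul_pf hA (Fin.cons b (Fin.cons c (Fin.cons d w)) : Fin (k + 3) → L)
    (Fin.cons a w : Fin (k + 1) → L)
  have hr : ∀ i : Fin k, pf A (k + 2 + 2) (Fin.cons (w i)
      (Fin.cons b (Fin.cons c (Fin.cons d w)))) = 0 := fun i => by
    have := pf_cons_eq_zero hA (Fin.cons b (Fin.cons c (Fin.cons d w)) : Fin (k + 3) → L)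
      i.succ.succ.succ
    simpa only [Fin.cons_succ] using this
  rw [Fin.sum_univ_succ, Fin.sum_univ_succ, Fin.sum_univ_succ, Fin.sum_univ_succ] at h
  simp only [Fin.cons_succ, Fin.cons_zero, removeNth_succ_cons, removeNth_zero_cons,
    Fin.val_zero, Fin.val_succ, pf_cons_cons_eq_zero hA, hr, mul_zero, zero_mul,
    Finset.sum_const_zero] at h
  linear_combination h

/-- Ohta's identity for `(a, b, c, d, w)` and `w`. Here the whole right-hand side vanishes, by
repeated labels. -/
theorem pf_plucker_odd {A : L → L → ℝ} (hA : ∀ x y, A x y = -A y x) {k : ℕ} (a b c d : L)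
    (w : Fin (k + 1) → L) :
    pf A (k + 4) (Fin.cons b (Fin.cons c (Fin.cons d w))) * pf A (k + 2) (Fin.cons a w) -
      pf A (k + 4) (Fin.cons a (Fin.cons c (Fin.cons d w))) * pf A (k + 2) (Fin.cons b w) +
      pf A (k + 4) (Fin.cons a (Fin.cons b (Fin.cons d w))) * pf A (k + 2) (Fin.cons c w) -
      pf A (k + 4) (Fin.cons a (Fin.cons b (Fin.cons c w))) * pf A (k + 2) (Fin.cons d w) =
      0 := by
  have h := sum_pf_mul_pf hA
    (Fin.cons a (Fin.cons b (Fin.cons c (Fin.cons d w))) : Fin (k + 5) → L) w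
  have hr : ∀ i : Fin (k + 1), pf A (k + 4 + 2) (Fin.cons (w i)
      (Fin.cons a (Fin.cons b (Fin.cons c (Fin.cons d w))))) = 0 := fun i => by
    have := pf_cons_eq_zero hA
      (Fin.cons a (Fin.cons b (Fin.cons c (Fin.cons d w))) : Fin (k + 5) → L)
      i.succ.succ.succ.succ
    simpa only [Fin.cons_succ] using this
  rw [Fin.sum_univ_succ, Fin.sum_univ_succ, Fin.sum_univ_succ, Fin.sum_univ_succ] at h
  simp only [Fin.cons_succ, Fin.cons_zero, removeNth_succ_cons, removeNth_zero_cons,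
    Fin.val_zero, Fin.val_succ, pf_cons_eq_zero hA, hr, mul_zero, zero_mul,
    Finset.sum_const_zero] at h
  linear_combination h

/-- The row of `x` is expanded instead of that of `a`. For `a = d₀`, `b = d₁` the bracket is the
derivative of a bimoment, which is what the induction in `hasDerivAt_pf_nums` needs. -/
theorem pf_cons_cons_cons {A : L → L → ℝ} (hA : ∀ x y, A x y = -A y x) {m : ℕ} (a b x : L)
    (w : Fin (m + 1) → L) :
    pf A (m + 4) (Fin.cons a (Fin.cons b (Fin.cons x w))) =
      ∑ j : Fin (m + 1), (-1) ^ (j : ℕ) * ((A x a * A b (w j) - A x b * A a (w j)) *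
          pf A m (j.removeNth w) +
        A x (w j) * pf A (m + 2) (Fin.cons a (Fin.cons b (j.removeNth w)))) := by
  rw [pf_cons_swap hA, pf_swap hA, neg_neg, pf_cons, Fin.sum_univ_succ, Fin.sum_univ_succ]
  simp only [Fin.cons_succ, Fin.cons_zero, removeNth_succ_cons, removeNth_zero_cons,
    Fin.val_zero, Fin.val_succ]
  rw [pf_cons, pf_cons, Finset.mul_sum, Finset.mul_sum, ← Finset.sum_add_distrib,
    ← Finset.sum_add_distrib]
  refine Finset.sum_congr rfl fun j _ => ?_
  ring

end BToda

/-! ### Two formulas for the derivative of a Pfaffian of moments. -/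

namespace BToda

theorem mu_swap (ρ : ℝ → ℝ) (i j : ℕ) (t : ℝ) : mu ρ i j t = -mu ρ j i t := by
  unfold mu
  rw [Measure.volume_eq_prod, ← setIntegral_prod_swap, ← integral_neg]
  refine integral_congr_ae (Filter.Eventually.of_forall fun p => ?_)
  simp only [muIntegrand, Prod.fst_swap, Prod.snd_swap]
  rw [add_comm p.2 p.1, ← neg_sub p.1 p.2, neg_div]
  ring

theorem entry_swap (ρ : ℝ → ℝ) (t : ℝ) (x y : Label) : entry ρ t x y = -entry ρ t y x := by
  cases x <;> cases y <;> simp [entry]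
  exact mu_swap ρ _ _ t

/-- The evolution of the moments and bimoments at time `t`. -/
structure MomentFlow (ρ : ℝ → ℝ) (t : ℝ) : Prop where
  beta : ∀ i, HasDerivAt (beta ρ i) (beta ρ (i + 1) t) t
  mu : ∀ i j, HasDerivAt (mu ρ i j) (mu ρ (i + 1) j t + mu ρ i (j + 1) t) t
  mu_eq : ∀ i j, BToda.mu ρ (i + 1) j t + BToda.mu ρ i (j + 1) t =
    BToda.beta ρ (i + 1) t * BToda.beta ρ j t - BToda.beta ρ i t * BToda.beta ρ (j + 1) t

variable {ρ : ℝ → ℝ} {t : ℝ}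

/-- The list of numerical labels `v`. -/
def nums {m : ℕ} (v : Fin m → ℕ) : Fin m → Label := fun i => .num (v i)

/-- Induction by the product rule in the row expansion: by `mu_eq` the differentiated entries supply
the bracket of `pf_cons_cons_cons`, the differentiated minors its last term. It starts from `Pf(d₀,
d₁) = 0`. -/
theorem hasDerivAt_pf_nums (h : MomentFlow ρ t) : ∀ (m : ℕ) (v : Fin m → ℕ),
    HasDerivAt (fun s => pf (entry ρ s) m (nums v))
      (pf (entry ρ t) (m + 2) (Fin.cons .d0 (Fin.cons .d1 (nums v)))) t
  | 0, v => by
    simpa [pf, entry] using hasDerivAt_const t (1 : ℝ)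
  | 1, v => by
    refine HasDerivAt.congr_deriv (f' := 0) ?_
      (pf_odd (entry ρ t) 1 (Fin.cons .d0 (Fin.cons .d1 (nums v)))).symm
    simpa [pf] using hasDerivAt_const t (0 : ℝ)
  | m + 2, v => by
    have ih := fun w => hasDerivAt_pf_nums h m w
    have hv : nums v = Fin.cons (.num (v 0)) (nums (Fin.tail v)) := by
      funext k
      refine Fin.cases ?_ (fun k => ?_) k <;> simp [nums, Fin.tail]
    rw [hv, pf_cons_cons_cons (entry_swap ρ t)]
    simp only [pf_cons]
    refine HasDerivAt.fun_sum fun j _ => ?_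
    have h1 := ((h.mu (v 0) (Fin.tail v j)).const_mul ((-1) ^ (j : ℕ))).mul
      (ih (j.removeNth (Fin.tail v)))
    refine h1.congr_deriv ?_
    rw [h.mu_eq]
    change _ = (-1) ^ (j : ℕ) * ((-BToda.beta ρ (v 0) t * BToda.beta ρ (Fin.tail v j + 1) t -
      -BToda.beta ρ (v 0 + 1) t * BToda.beta ρ (Fin.tail v j) t) *
        pf (entry ρ t) m (nums (j.removeNth (Fin.tail v))) + BToda.mu ρ (v 0) (Fin.tail v j) t *
        pf (entry ρ t) (m + 2) (Fin.cons .d0 (Fin.cons .d1 (nums (j.removeNth (Fin.tail v))))))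
    ring

theorem hasDerivAt_pf_d0_nums (h : MomentFlow ρ t) (m : ℕ) (v : Fin (m + 1) → ℕ) :
    HasDerivAt (fun s => pf (entry ρ s) (m + 2) (Fin.cons .d0 (nums v)))
      (pf (entry ρ t) (m + 2) (Fin.cons .d1 (nums v))) t := by
  simp only [pf_cons]
  have h1 : HasDerivAt (fun s => ∑ j : Fin (m + 1), (-1) ^ (j : ℕ) *
      entry ρ s .d0 (nums v j) * pf (entry ρ s) m (j.removeNth (nums v)))
      (∑ j : Fin (m + 1), ((-1) ^ (j : ℕ) * BToda.beta ρ (v j + 1) t *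
        pf (entry ρ t) m (j.removeNth (nums v)) + (-1) ^ (j : ℕ) * BToda.beta ρ (v j) t *
        pf (entry ρ t) (m + 2) (Fin.cons .d0 (Fin.cons .d1 (j.removeNth (nums v)))))) t :=
    HasDerivAt.fun_sum fun j _ => ((h.beta (v j)).const_mul ((-1) ^ (j : ℕ))).mul
      (hasDerivAt_pf_nums h m (j.removeNth v))
  refine h1.congr_deriv ?_
  -- The terms with differentiated minors form the first-row expansion of `Pf(d₀, d₀, d₁, v)`,
  -- because `Pf(d₀, d₀) = Pf(d₀, d₁) = 0`; a repeated label makes it vanish.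
  have h0 : pf (entry ρ t) (m + 4) (Fin.cons .d0 (Fin.cons .d0 (Fin.cons .d1 (nums v)))) = 0 :=
    pf_cons_eq_zero (entry_swap ρ t) (Fin.cons .d0 (Fin.cons .d1 (nums v)) : Fin (m + 3) → Label) 0
  rw [pf_cons, Fin.sum_univ_succ, Fin.sum_univ_succ] at h0
  simp only [Fin.cons_succ, Fin.cons_zero, removeNth_succ_cons, removeNth_zero_cons,
    Fin.val_zero, Fin.val_succ, entry, mul_zero, zero_mul, zero_add, nums] at h0
  rw [Finset.sum_add_distrib]
  have h2 : ∑ j : Fin (m + 1), (-1) ^ (j : ℕ) * BToda.beta ρ (v j) t *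
        pf (entry ρ t) (m + 2) (Fin.cons .d0 (Fin.cons .d1 (j.removeNth (nums v)))) = 0 := by
    rw [← h0]
    refine Finset.sum_congr rfl fun j _ => ?_
    simp only [pow_succ]
    ring
  rw [h2, add_zero]
  rfl

theorem hasDerivAt_pf_nums_update (h : MomentFlow ρ t) : ∀ (m : ℕ) (v : Fin m → ℕ),
    HasDerivAt (fun s => pf (entry ρ s) m (nums v))
      (∑ k, pf (entry ρ t) m (nums (Function.update v k (v k + 1)))) t
  | 0, v => by
    simpa [pf, entry] using hasDerivAt_const t (1 : ℝ)
  | 1, v => by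
    simpa [pf] using hasDerivAt_const t (0 : ℝ)
  | m + 2, v => by
    have ih := fun w => hasDerivAt_pf_nums_update h m w
    have h1 : HasDerivAt (fun s => ∑ j : Fin (m + 1), (-1) ^ (j : ℕ) *
        entry ρ s (.num (v 0)) (.num (v j.succ)) *
          pf (entry ρ s) m (nums (j.removeNth (Fin.tail v)))) _ t :=
      HasDerivAt.fun_sum fun j _ => ((h.mu (v 0) (v j.succ)).const_mul ((-1) ^ (j : ℕ))).mul
        (ih (j.removeNth (Fin.tail v)))
    refine h1.congr_deriv ?_
    have h2 : ∀ w : Fin (m + 2) → ℕ, pf (entry ρ t) (m + 2) (nums w) =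
      ∑ j : Fin (m + 1), (-1) ^ (j : ℕ) * BToda.mu ρ (w 0) (w j.succ) t *
          pf (entry ρ t) m (nums (j.removeNth (Fin.tail w))) := fun w => rfl
    simp only [h2]
    rw [Finset.sum_comm]
    refine Finset.sum_congr rfl fun j _ => ?_
    -- In the `j`-th term of the expansion, raising label `0` or `j.succ` changes the entry, raising
    -- any other label changes the minor.
    rw [Fin.sum_univ_succ, Fin.sum_univ_succAbove _ j]
    have e0 : j.removeNth (Fin.tail (Function.update v 0 (v 0 + 1))) =
        j.removeNth (Fin.tail v) := by
      funext i
      simp [Fin.removeNth, Fin.tail]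
    have e1 : j.removeNth (Fin.tail (Function.update v j.succ (v j.succ + 1))) =
        j.removeNth (Fin.tail v) := by
      funext i
      simp [Fin.removeNth, Fin.tail]
    have e2 : ∀ k : Fin m, j.removeNth (Fin.tail (Function.update v (j.succAbove k).succ
        (v (j.succAbove k).succ + 1))) =
        Function.update (j.removeNth (Fin.tail v)) k (j.removeNth (Fin.tail v) k + 1) := by
      intro k
      funext i
      rcases eq_or_ne i k with rfl | hik
      · simp [Fin.removeNth, Fin.tail]
      · simp [Fin.removeNth, Fin.tail, hik]
    have e3 : ∀ k : Fin m, Function.update v (j.succAbove k).succ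
        (v (j.succAbove k).succ + 1) j.succ = v j.succ := by
      intro k
      simp [Fin.succ_inj, Fin.ne_succAbove]
    have e4 : ∀ (i : Fin (m + 1)) (c : ℕ), Function.update v i.succ c 0 = v 0 := by
      intro i c
      simp [(Fin.succ_ne_zero i).symm]
    have e5 : Function.update v 0 (v 0 + 1) j.succ = v j.succ := by simp
    simp only [e0, e1, e2, e3, e4, e5, Function.update_self, ← Finset.mul_sum]
    change (-1) ^ (j : ℕ) * _ * _ + (-1) ^ (j : ℕ) * BToda.mu ρ (v 0) (v j.succ) t * _ = _
    ring

theorem hasDerivAt_pf_d0_nums_update (h : MomentFlow ρ t) (m : ℕ) (v : Fin (m + 1) → ℕ) :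
    HasDerivAt (fun s => pf (entry ρ s) (m + 2) (Fin.cons .d0 (nums v)))
      (∑ k, pf (entry ρ t) (m + 2) (Fin.cons .d0 (nums (Function.update v k (v k + 1))))) t := by
  simp only [pf_cons]
  have h1 : HasDerivAt (fun s => ∑ j : Fin (m + 1), (-1) ^ (j : ℕ) *
      entry ρ s .d0 (nums v j) * pf (entry ρ s) m (j.removeNth (nums v))) _ t :=
    HasDerivAt.fun_sum fun j _ => ((h.beta (v j)).const_mul ((-1) ^ (j : ℕ))).mul
      (hasDerivAt_pf_nums_update h m (j.removeNth v))
  refine h1.congr_deriv ?_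
  rw [Finset.sum_comm]
  refine Finset.sum_congr rfl fun j _ => ?_
  rw [Fin.sum_univ_succAbove _ j]
  have e1 : j.removeNth (nums (Function.update v j (v j + 1))) = nums (j.removeNth v) := by
    funext i
    simp [Fin.removeNth, nums]
  have e2 : ∀ k : Fin m, j.removeNth (nums (Function.update v (j.succAbove k)
      (v (j.succAbove k) + 1))) =
      nums (Function.update (j.removeNth v) k (j.removeNth v k + 1)) := by
    intro k
    funext i
    rcases eq_or_ne i k with rfl | hik
    · simp [Fin.removeNth, nums]
    · simp [Fin.removeNth, nums, hik]
  have e3 : ∀ k : Fin m, nums (Function.update v (j.succAbove k)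
      (v (j.succAbove k) + 1)) j = .num (v j) := by
    intro k
    simp [nums, Fin.ne_succAbove]
  have e4 : nums (Function.update v j (v j + 1)) j = .num (v j + 1) := by simp [nums]
  simp only [e1, e2, e3, e4, ← Finset.mul_sum]
  rfl

/-- The labels `0, 1, …, m - 1`. -/
def initLabels (m : ℕ) : Fin m → Label := fun i => .num i

/-- Raising `k < m` in `0, …, m` repeats the label `k + 1`, so only raising the last label counts. A
general `F` covers lists with and without `d₀`. -/
theorem sum_update_nums_eq (m : ℕ) (F : (Fin (m + 1) → Label) → ℝ)
    (hF : ∀ (w : Fin (m + 1) → Label) (i j : Fin (m + 1)), i ≠ j → w i = w j → F w = 0) :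
    ∑ k : Fin (m + 1), F (nums (Function.update (fun i => (i : ℕ)) k ((k : ℕ) + 1))) =
      F (Fin.snoc (initLabels m) (.num (m + 1)) : Fin (m + 1) → Label) := by
  rw [Fin.sum_univ_castSucc, Finset.sum_eq_zero, zero_add]
  · congr 1
    funext i
    refine Fin.lastCases ?_ (fun i => ?_) i
    · simp [nums]
    · simp [nums, initLabels, (Fin.castSucc_lt_last i).ne]
  · intro k _
    refine hF _ k.castSucc k.succ (Fin.castSucc_lt_succ).ne ?_
    have : k.succ ≠ k.castSucc := (Fin.castSucc_lt_succ).ne'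
    simp [nums, this]

theorem initLabels_succ (m : ℕ) :
    initLabels (m + 1) = (Fin.snoc (initLabels m) (.num m) : Fin (m + 1) → Label) := by
  funext i
  refine Fin.lastCases ?_ (fun i => ?_) i <;> simp [initLabels]

theorem snoc_initLabels_eq_nums (m c : ℕ) :
    (Fin.snoc (initLabels m) (.num c) : Fin (m + 1) → Label) =
      nums (Fin.snoc (fun i : Fin m => (i : ℕ)) c : Fin (m + 1) → ℕ) := by
  funext i
  refine Fin.lastCases ?_ (fun i => ?_) i <;> simp [initLabels, nums]

theorem hasDerivAt_pf_init (h : MomentFlow ρ t) (m : ℕ) :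
    HasDerivAt (fun s => pf (entry ρ s) (m + 1) (initLabels (m + 1)))
      (pf (entry ρ t) (m + 1) (Fin.snoc (initLabels m) (.num (m + 1)) : Fin (m + 1) → Label)) t := by
  refine (hasDerivAt_pf_nums_update h (m + 1) fun i => (i : ℕ)).congr_deriv ?_
  exact sum_update_nums_eq m (pf (entry ρ t) (m + 1))
    fun w i j hij hw => pf_eq_zero_of_eq (entry_swap ρ t) _ _ hij hw

theorem hasDerivAt_pf_d0_init (h : MomentFlow ρ t) (m : ℕ) :
    HasDerivAt (fun s => pf (entry ρ s) (m + 2) (Fin.cons .d0 (initLabels (m + 1))))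
      (pf (entry ρ t) (m + 2) (Fin.cons .d0
        (Fin.snoc (initLabels m) (.num (m + 1)) : Fin (m + 1) → Label))) t := by
  refine (hasDerivAt_pf_d0_nums_update h m fun i => (i : ℕ)).congr_deriv ?_
  refine sum_update_nums_eq m
    (fun w => pf (entry ρ t) (m + 2) (Fin.cons .d0 w)) fun w i j hij hw => ?_
  exact pf_eq_zero_of_eq (entry_swap ρ t) _ _ (i := i.succ) (j := j.succ)
    (fun h => hij (Fin.succ_injective _ h)) (by simpa using hw)

end BToda

/-! ### The tau-functions: derivatives and the bilinear equation. -/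

namespace BToda

theorem tau_two_mul (ρ : ℝ → ℝ) (n : ℕ) (t : ℝ) :
    tau ρ (2 * n) t = Pf ρ t (evenLabels n) := by
  have h : 2 * n / 2 = n := by omega
  unfold tau
  rw [if_pos (even_two_mul n), h]

theorem tau_two_mul_add_one (ρ : ℝ → ℝ) (n : ℕ) (t : ℝ) :
    tau ρ (2 * n + 1) t = Pf ρ t (oddLabels n) := by
  have h : (2 * n + 1) / 2 = n := by omega
  unfold tau
  rw [if_neg (Nat.not_even_iff_odd.2 (odd_two_mul_add_one n)), h]

theorem Pf_eq_pf (ρ : ℝ → ℝ) (t : ℝ) {n : ℕ} (a : Fin (2 * n) → Label) :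
    Pf ρ t a = pf (entry ρ t) (2 * n) a :=
  pfaffian_eq_pf (entry_swap ρ t) n a

theorem tau_even_eq_pf (ρ : ℝ → ℝ) (n : ℕ) (t : ℝ) :
    tau ρ (2 * n) t = pf (entry ρ t) (2 * n) (initLabels (2 * n)) := by
  rw [tau_two_mul, Pf_eq_pf]
  rfl

theorem tau_odd_eq_pf (ρ : ℝ → ℝ) (n : ℕ) (t : ℝ) :
    tau ρ (2 * n + 1) t =
      pf (entry ρ t) (2 * n + 2) (Fin.cons .d0 (initLabels (2 * n + 1))) := by
  rw [tau_two_mul_add_one, Pf_eq_pf]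
  change pf (entry ρ t) (2 * n + 1 + 1) (oddLabels n) = _
  congr 1
  funext i
  refine Fin.cases ?_ (fun i => ?_) i
  · simp [oddLabels]
  · simp [oddLabels, initLabels]

variable {ρ : ℝ → ℝ} {t : ℝ}

theorem hasDerivAt_tau_even (h : MomentFlow ρ t) (n : ℕ) :
    HasDerivAt (tau ρ (2 * n)) (pf (entry ρ t) (2 * n + 2)
      (Fin.cons .d0 (Fin.cons .d1 (initLabels (2 * n))))) t := by
  rw [funext (tau_even_eq_pf ρ n)]
  exact hasDerivAt_pf_nums h _ _

theorem hasDerivAt_tau_odd (h : MomentFlow ρ t) (n : ℕ) :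
    HasDerivAt (tau ρ (2 * n + 1)) (pf (entry ρ t) (2 * n + 2)
      (Fin.cons .d1 (initLabels (2 * n + 1)))) t := by
  rw [funext (tau_odd_eq_pf ρ n)]
  exact hasDerivAt_pf_d0_nums h _ _

theorem hasDerivAt_tau_even' (h : MomentFlow ρ t) (n : ℕ) :
    HasDerivAt (tau ρ (2 * (n + 1))) (pf (entry ρ t) (2 * n + 2)
      (Fin.snoc (initLabels (2 * n + 1)) (.num (2 * n + 2)) : Fin (2 * n + 2) → Label)) t := by
  rw [funext (tau_even_eq_pf ρ (n + 1))]
  exact hasDerivAt_pf_init h _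

theorem hasDerivAt_tau_odd' (h : MomentFlow ρ t) (n : ℕ) :
    HasDerivAt (tau ρ (2 * n + 1)) (pf (entry ρ t) (2 * n + 2) (Fin.cons .d0
      (Fin.snoc (initLabels (2 * n)) (.num (2 * n + 1)) : Fin (2 * n + 1) → Label))) t := by
  rw [funext (tau_odd_eq_pf ρ n)]
  exact hasDerivAt_pf_d0_init h _

/-- The raised form of the first derivative again has only numerical labels, so `hasDerivAt_pf_nums`
applies a second time. -/
theorem hasDerivAt_deriv_tau_even (h : ∀ᶠ s in nhds t, MomentFlow ρ s) (n : ℕ) :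
    HasDerivAt (deriv (tau ρ (2 * (n + 1)))) (pf (entry ρ t) (2 * n + 4)
      (Fin.cons .d0 (Fin.cons .d1 (Fin.snoc (initLabels (2 * n + 1)) (.num (2 * n + 2)) :
        Fin (2 * n + 2) → Label)))) t := by
  have h1 : deriv (tau ρ (2 * (n + 1))) =ᶠ[nhds t] fun s => pf (entry ρ s) (2 * n + 2)
      (Fin.snoc (initLabels (2 * n + 1)) (.num (2 * n + 2)) : Fin (2 * n + 2) → Label) :=
    h.mono fun s hs => (hasDerivAt_tau_even' hs n).deriv
  refine HasDerivAt.congr_of_eventuallyEq ?_ h1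
  rw [snoc_initLabels_eq_nums]
  exact hasDerivAt_pf_nums h.self_of_nhds _ _

theorem hasDerivAt_deriv_tau_odd (h : ∀ᶠ s in nhds t, MomentFlow ρ s) (n : ℕ) :
    HasDerivAt (deriv (tau ρ (2 * n + 1))) (pf (entry ρ t) (2 * n + 2) (Fin.cons .d1
      (Fin.snoc (initLabels (2 * n)) (.num (2 * n + 1)) : Fin (2 * n + 1) → Label))) t := by
  have h1 : deriv (tau ρ (2 * n + 1)) =ᶠ[nhds t] fun s => pf (entry ρ s) (2 * n + 2)
      (Fin.cons .d0 (Fin.snoc (initLabels (2 * n)) (.num (2 * n + 1)) :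
        Fin (2 * n + 1) → Label)) :=
    h.mono fun s hs => (hasDerivAt_tau_odd' hs n).deriv
  refine HasDerivAt.congr_of_eventuallyEq ?_ h1
  rw [snoc_initLabels_eq_nums]
  exact hasDerivAt_pf_d0_nums h.self_of_nhds _ _

theorem tau_zero (ρ : ℝ → ℝ) : tau ρ 0 = fun _ => 1 := by
  funext s
  exact (tau_even_eq_pf ρ 0 s).trans rfl

theorem differentiableAt_tau (h : MomentFlow ρ t) (n : ℕ) : DifferentiableAt ℝ (tau ρ n) t := by
  rcases Nat.even_or_odd' n with ⟨k, rfl | rfl⟩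
  · exact (hasDerivAt_tau_even h k).differentiableAt
  · exact (hasDerivAt_tau_odd h k).differentiableAt

theorem differentiableAt_deriv_tau (h : ∀ᶠ s in nhds t, MomentFlow ρ s) (n : ℕ) :
    DifferentiableAt ℝ (deriv (tau ρ n)) t := by
  rcases Nat.even_or_odd' n with ⟨k, rfl | rfl⟩
  · cases k with
    | zero => simp [tau_zero]
    | succ k => exact (hasDerivAt_deriv_tau_even h k).differentiableAt
  · exact (hasDerivAt_deriv_tau_odd h k).differentiableAt

/-- With `N = (0, …, 2p - 1)`, this is the Plücker relation for `d₀, d₁, 2p, 2p + 1` over `N`. The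
index of `τ` is odd, but `N` has even length. -/
theorem tau_bilinear_odd (h : ∀ᶠ s in nhds t, MomentFlow ρ s) (p : ℕ) :
    deriv (deriv (tau ρ (2 * p + 1))) t * tau ρ (2 * p + 1) t -
        deriv (tau ρ (2 * p + 1)) t ^ 2 =
      deriv (tau ρ (2 * p)) t * tau ρ (2 * (p + 1)) t -
        deriv (tau ρ (2 * (p + 1))) t * tau ρ (2 * p) t := by
  have h0 := h.self_of_nhds
  have hA := entry_swap ρ t
  have hs : ((-1 : ℝ)) ^ (2 * p) = 1 := (even_two_mul p).neg_one_pow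
  have e1 := (hasDerivAt_tau_odd h0 p).deriv
  have e2 := (hasDerivAt_tau_odd' h0 p).deriv
  have e3 := (hasDerivAt_deriv_tau_odd h p).deriv
  have e4 := tau_odd_eq_pf ρ p t
  have e5 := (hasDerivAt_tau_even h0 p).deriv
  have e6 := tau_even_eq_pf ρ p t
  have e7 : deriv (tau ρ (2 * (p + 1))) t = pf (entry ρ t) (2 * p + 4)
      (Fin.cons .d0 (Fin.cons .d1 (initLabels (2 * p + 2)))) :=
    (hasDerivAt_tau_even h0 (p + 1)).deriv
  have e8 : tau ρ (2 * (p + 1)) t = pf (entry ρ t) (2 * p + 2) (initLabels (2 * p + 2)) :=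
    tau_even_eq_pf ρ (p + 1) t
  rw [initLabels_succ, pf_cons_snoc hA, hs, one_mul] at e1 e4
  rw [pf_cons_snoc hA, hs, one_mul] at e2 e3
  rw [initLabels_succ (2 * p + 1), initLabels_succ (2 * p), pf_snoc_snoc hA] at e8
  rw [initLabels_succ (2 * p + 1), initLabels_succ (2 * p), pf_cons_cons_snoc_snoc hA] at e7
  have hP := pf_plucker_even hA .d0 .d1 (.num (2 * p)) (.num (2 * p + 1)) (initLabels (2 * p))
  rw [pf_swap hA .d1 .d0, pf_swap hA (.num (2 * p)) .d0, pf_swap hA (.num (2 * p + 1)) .d0] at hP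
  rw [sq]
  -- The two factors of the square take different forms: `Pf(d₁, N, 2p)` and `Pf(d₀, N, 2p + 1)`.
  nth_rewrite 2 [e1]
  rw [e2, e3, e4, e5, e6, e7, e8]
  linear_combination hP

theorem tau_bilinear_even (h : ∀ᶠ s in nhds t, MomentFlow ρ s) (p : ℕ) :
    deriv (deriv (tau ρ (2 * (p + 1)))) t * tau ρ (2 * (p + 1)) t -
        deriv (tau ρ (2 * (p + 1))) t ^ 2 =
      deriv (tau ρ (2 * p + 1)) t * tau ρ (2 * (p + 1) + 1) t -
        deriv (tau ρ (2 * (p + 1) + 1)) t * tau ρ (2 * p + 1) t := by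
  have h0 := h.self_of_nhds
  have hA := entry_swap ρ t
  have hs : ((-1 : ℝ)) ^ (2 * p + 1) = -1 := (odd_two_mul_add_one p).neg_one_pow
  have e1 : deriv (tau ρ (2 * (p + 1))) t = pf (entry ρ t) (2 * p + 4)
      (Fin.cons .d0 (Fin.cons .d1 (initLabels (2 * p + 2)))) :=
    (hasDerivAt_tau_even h0 (p + 1)).deriv
  have e2 := (hasDerivAt_tau_even' h0 p).deriv
  have e3 := (hasDerivAt_deriv_tau_even h p).deriv
  have e4 : tau ρ (2 * (p + 1)) t = pf (entry ρ t) (2 * p + 2) (initLabels (2 * p + 2)) :=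
    tau_even_eq_pf ρ (p + 1) t
  have e5 := (hasDerivAt_tau_odd h0 p).deriv
  have e6 := tau_odd_eq_pf ρ p t
  have e7 : deriv (tau ρ (2 * (p + 1) + 1)) t = pf (entry ρ t) (2 * p + 4)
      (Fin.cons .d1 (initLabels (2 * p + 3))) :=
    (hasDerivAt_tau_odd h0 (p + 1)).deriv
  have e8 : tau ρ (2 * (p + 1) + 1) t = pf (entry ρ t) (2 * p + 4)
      (Fin.cons .d0 (initLabels (2 * p + 3))) :=
    tau_odd_eq_pf ρ (p + 1) t
  rw [initLabels_succ (2 * p + 1), pf_cons_cons_snoc hA, hs] at e1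
  rw [initLabels_succ (2 * p + 1), pf_snoc hA, hs] at e4
  rw [pf_snoc hA, hs] at e2
  rw [pf_cons_cons_snoc hA, hs] at e3
  rw [initLabels_succ (2 * p + 2), initLabels_succ (2 * p + 1), pf_cons_snoc_snoc hA] at e7 e8
  have hP := pf_plucker_odd hA .d0 .d1 (.num (2 * p + 1)) (.num (2 * p + 2))
    (initLabels (2 * p + 1))
  rw [sq]
  -- With `N = (0, …, 2p)`, the factors of the square are taken as `Pf(d₀, d₁, N, 2p + 1)` and
  -- `Pf(N, 2p + 2)`.
  nth_rewrite 2 [e1]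
  rw [e2, e3, e4, e5, e6, e7, e8]
  linear_combination hP

theorem tau_bilinear (h : ∀ᶠ s in nhds t, MomentFlow ρ s) {n : ℕ} (hn : 1 ≤ n) :
    deriv (deriv (tau ρ n)) t * tau ρ n t - deriv (tau ρ n) t ^ 2 =
      deriv (tau ρ (n - 1)) t * tau ρ (n + 1) t -
        deriv (tau ρ (n + 1)) t * tau ρ (n - 1) t := by
  rcases Nat.even_or_odd' n with ⟨k, rfl | rfl⟩
  · obtain ⟨p, rfl⟩ : ∃ p, k = p + 1 := ⟨k - 1, by omega⟩
    exact tau_bilinear_even h p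
  · exact tau_bilinear_odd h k

end BToda

/-! ### Differentiation of moments and bimoments under the integral sign. -/

namespace BToda

theorem hasDerivAt_integral_mul_exp {α : Type*} [MeasurableSpace α] {μ : Measure α} {I : Set ℝ}
    (hI : IsOpen I) {f φ : α → ℝ} (hφ : ∀ᵐ x ∂μ, 0 ≤ φ x)
    (h : ∀ s ∈ I, Integrable (fun x => f x * Real.exp (s * φ x)) μ)
    (h' : ∀ s ∈ I, Integrable (fun x => f x * φ x * Real.exp (s * φ x)) μ) {t : ℝ} (ht : t ∈ I) :
    HasDerivAt (fun s => ∫ x, f x * Real.exp (s * φ x) ∂μ)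
      (∫ x, f x * φ x * Real.exp (t * φ x) ∂μ) t := by
  obtain ⟨ε, hε, hball⟩ := Metric.isOpen_iff.1 hI t ht
  -- As `φ ≥ 0`, the exponential increases with `s`, so the integrand at the right end `t + ε / 2`
  -- dominates the whole ball of radius `ε / 2`.
  have hmem : t + ε / 2 ∈ I := hball (by
    rw [Metric.mem_ball, Real.dist_eq, add_sub_cancel_left, abs_of_pos (by positivity)]
    linarith)
  refine (hasDerivAt_integral_of_dominated_loc_of_deriv_le
    (F := fun s x => f x * Real.exp (s * φ x))
    (F' := fun s x => f x * φ x * Real.exp (s * φ x))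
    (bound := fun x => ‖f x * φ x * Real.exp ((t + ε / 2) * φ x)‖)
    (Metric.ball_mem_nhds t (half_pos hε)) ?_ (h t ht) (h' t ht).aestronglyMeasurable ?_
    (h' _ hmem).norm ?_).2
  · filter_upwards [hI.mem_nhds ht] with s hs using (h s hs).aestronglyMeasurable
  · filter_upwards [hφ] with x hx s hs
    rw [Metric.mem_ball, Real.dist_eq, abs_lt] at hs
    rw [norm_mul, norm_mul _ (Real.exp _), Real.norm_of_nonneg (Real.exp_pos _).le,
      Real.norm_of_nonneg (Real.exp_pos _).le]
    gcongr
    linarith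
  · refine Filter.Eventually.of_forall fun x s _ => ?_
    have := (((hasDerivAt_id s).mul_const (φ x)).exp).const_mul (f x)
    refine this.congr_deriv ?_
    simp only [id]
    ring

theorem restrict_prod_Ioi : (volume : Measure (ℝ × ℝ)).restrict (Ioi (0 : ℝ) ×ˢ Ioi (0 : ℝ)) =
    (volume.restrict (Ioi (0 : ℝ))).prod (volume.restrict (Ioi (0 : ℝ))) := by
  rw [Measure.prod_restrict, Measure.volume_eq_prod]

theorem ae_mem_prod_Ioi : ∀ᵐ p : ℝ × ℝ ∂volume.restrict (Ioi (0 : ℝ) ×ˢ Ioi (0 : ℝ)),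
    0 < p.1 ∧ 0 < p.2 := by
  filter_upwards [ae_restrict_mem (measurableSet_Ioi.prod measurableSet_Ioi)] with p hp
  exact hp

/-- The weighted monomial `x^i e^{tx} ρ(x)`. -/
noncomputable def weighted (ρ : ℝ → ℝ) (t : ℝ) (i : ℕ) (x : ℝ) : ℝ := x ^ i * Real.exp (t * x) * ρ x

theorem muIntegrand_eq (ρ : ℝ → ℝ) (i j : ℕ) (t : ℝ) (p : ℝ × ℝ) :
    muIntegrand ρ i j t p =
      (p.1 - p.2) / (p.1 + p.2) * (weighted ρ t i p.1 * weighted ρ t j p.2) := by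
  unfold muIntegrand weighted
  rw [mul_add, Real.exp_add]
  ring

theorem integrableOn_muIntegrand {ρ : ℝ → ℝ} {t : ℝ}
    (h : ∀ i, IntegrableOn (weighted ρ t i) (Ioi 0)) (i j : ℕ) :
    IntegrableOn (muIntegrand ρ i j t) (Ioi (0 : ℝ) ×ˢ Ioi (0 : ℝ)) := by
  have h1 : Integrable (fun p : ℝ × ℝ => weighted ρ t i p.1 * weighted ρ t j p.2)
      (volume.restrict (Ioi (0 : ℝ) ×ˢ Ioi (0 : ℝ))) := by
    rw [restrict_prod_Ioi]
    exact Integrable.mul_prod (h i) (h j)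
  unfold IntegrableOn
  rw [funext (muIntegrand_eq ρ i j t)]
  -- On the positive quadrant `|x - y| ≤ x + y`, so the kernel is bounded by 1.
  refine Integrable.bdd_mul (c := 1) h1 ?_ ?_
  · exact Measurable.aestronglyMeasurable (by fun_prop)
  · filter_upwards [ae_mem_prod_Ioi] with p hp
    rw [Real.norm_eq_abs, abs_div, abs_of_pos (add_pos hp.1 hp.2), div_le_one (add_pos hp.1 hp.2),
      abs_le]
    constructor <;> linarith [hp.1, hp.2]

theorem momentFlow {ρ : ℝ → ℝ} {I : Set ℝ} (hI : IsOpen I)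
    (h : ∀ t ∈ I, ∀ i, IntegrableOn (weighted ρ t i) (Ioi 0)) {t : ℝ} (ht : t ∈ I) :
    MomentFlow ρ t where
  beta i := by
    have key := hasDerivAt_integral_mul_exp (μ := volume.restrict (Ioi (0 : ℝ))) hI
      (f := fun x => x ^ i * ρ x) (φ := fun x => x) ?_ (fun s hs => ?_) (fun s hs => ?_) ht
    · convert key using 1
      · funext s
        exact integral_congr_ae (Filter.Eventually.of_forall fun x => by dsimp only; ring)
      · exact integral_congr_ae (Filter.Eventually.of_forall fun x => by dsimp only; ring)
    · filter_upwards [ae_restrict_mem measurableSet_Ioi] with x hx using le_of_lt hx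
    · exact (h s hs i).congr (Filter.Eventually.of_forall fun x => by
        simp only [weighted]; ring)
    · exact (h s hs (i + 1)).congr (Filter.Eventually.of_forall fun x => by
        simp only [weighted]; ring)
  mu i j := by
    have key := hasDerivAt_integral_mul_exp
      (μ := volume.restrict (Ioi (0 : ℝ) ×ˢ Ioi (0 : ℝ))) hI
      (f := fun p : ℝ × ℝ => p.1 ^ i * p.2 ^ j * ((p.1 - p.2) / (p.1 + p.2)) * ρ p.1 * ρ p.2)
      (φ := fun p => p.1 + p.2) ?_ (fun s hs => ?_) (fun s hs => ?_) ht
    · convert key using 1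
      · funext s
        exact integral_congr_ae (Filter.Eventually.of_forall fun x => by
          simp only [muIntegrand]; ring)
      · unfold BToda.mu
        rw [← integral_add (integrableOn_muIntegrand (h t ht) _ _)
          (integrableOn_muIntegrand (h t ht) _ _)]
        exact integral_congr_ae (Filter.Eventually.of_forall fun x => by
          simp only [muIntegrand]; ring)
    · filter_upwards [ae_mem_prod_Ioi] with p hp using (add_pos hp.1 hp.2).le
    · exact (integrableOn_muIntegrand (h s hs) i j).congr (Filter.Eventually.of_forall fun x => by
        simp only [muIntegrand]; ring)
    · exact ((integrableOn_muIntegrand (h s hs) (i + 1) j).add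
        (integrableOn_muIntegrand (h s hs) i (j + 1))).congr
        (Filter.Eventually.of_forall fun x => by
          simp only [muIntegrand, Pi.add_apply]; ring)
  mu_eq i j := by
    have hp : ∀ a b : ℕ, Integrable (fun p : ℝ × ℝ => weighted ρ t a p.1 * weighted ρ t b p.2)
        (volume.restrict (Ioi (0 : ℝ) ×ˢ Ioi (0 : ℝ))) := fun a b => by
      rw [restrict_prod_Ioi]
      exact Integrable.mul_prod (h t ht a) (h t ht b)
    have hi : ∀ a b : ℕ, ∫ p : ℝ × ℝ in Ioi (0 : ℝ) ×ˢ Ioi (0 : ℝ),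
        weighted ρ t a p.1 * weighted ρ t b p.2 = BToda.beta ρ a t * BToda.beta ρ b t :=
      fun a b => by
        rw [restrict_prod_Ioi]
        exact integral_prod_mul _ _
    rw [← hi, ← hi, ← integral_sub (hp _ _) (hp _ _)]
    unfold BToda.mu
    rw [← integral_add (integrableOn_muIntegrand (h t ht) _ _)
      (integrableOn_muIntegrand (h t ht) _ _)]
    -- The two bimoment integrands add up to a factor `x + y`, which cancels the denominator and
    -- leaves a difference of separated products.
    refine integral_congr_ae ?_
    filter_upwards [ae_mem_prod_Ioi] with p hp
    have hne : p.1 + p.2 ≠ 0 := (add_pos hp.1 hp.2).ne'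
    simp only [muIntegrand_eq]
    simp only [weighted]
    field_simp
    ring

end BToda

/-! ### Schur's Pfaffian. -/

namespace BToda

variable {L : Type*}

/-- The product `∏_{i<j} A(v_i, v_j)`. -/
def upperProd (A : L → L → ℝ) : (m : ℕ) → (Fin m → L) → ℝ
  | 0, _ => 1
  | m + 1, v => (∏ j : Fin m, A (v 0) (v j.succ)) * upperProd A m (Fin.tail v)

theorem upperProd_eq_prod (A : L → L → ℝ) (m : ℕ) (v : Fin m → L) :
    upperProd A m v = ∏ i : Fin m, ∏ j ∈ Finset.Ioi i, A (v i) (v j) := by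
  induction m with
  | zero => simp [upperProd]
  | succ m ih =>
    rw [upperProd, ih, Fin.prod_univ_succ]
    simp only [Fin.prod_Ioi_zero, Fin.prod_Ioi_succ]
    rfl

theorem upperProd_mul (A B : L → L → ℝ) (m : ℕ) (v : Fin m → L) :
    upperProd A m v * upperProd B m v = upperProd (fun x y => A x y * B x y) m v := by
  simp only [upperProd_eq_prod, ← Finset.prod_mul_distrib]

theorem upperProd_eq_removeNth {A : L → L → ℝ} (hA : ∀ x y, A x y = -A y x) :
    ∀ (m : ℕ) (v : Fin (m + 1) → L) (j : Fin (m + 1)),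
      upperProd A (m + 1) v = (-1) ^ (j : ℕ) * (∏ k : Fin m, A (v j) (v (j.succAbove k))) *
        upperProd A m (j.removeNth v)
  | 0, v, j => by
    obtain rfl : j = 0 := Fin.fin_one_eq_zero j
    simp [upperProd]
  | m + 1, v, j => by
    refine Fin.cases ?_ (fun j => ?_) j
    · rw [upperProd]
      simp only [Fin.val_zero, pow_zero, one_mul, Fin.zero_succAbove]
      rfl
    · rw [upperProd, upperProd_eq_removeNth hA m (Fin.tail v) j, Fin.prod_univ_succAbove _ j,
        Fin.prod_univ_succ, upperProd]
      simp only [Fin.succ_succAbove_zero, Fin.succ_succAbove_succ, Fin.val_succ, pow_succ]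
      have e1 : Fin.tail (j.succ.removeNth v) = j.removeNth (Fin.tail v) := by
        funext i
        simp [Fin.tail, Fin.removeNth]
      have e2 : (j.succ.removeNth v) 0 = v 0 := by simp [Fin.removeNth]
      have e3 : ∀ i : Fin m, (j.succ.removeNth v) i.succ = v (j.succAbove i).succ := by
        intro i
        simp [Fin.removeNth]
      rw [e1, hA (v 0) (v j.succ)]
      simp only [e2, e3]
      simp only [Fin.tail]
      ring

/-- Partial fractions in `z`. The polynomial `∏ (X - y_j) - ∏ (X + y_j)` has degree below `m`, as
both products are monic, so it equals its Lagrange interpolation at the nodes `-y_j`. -/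
theorem prod_sub_div_add (m : ℕ) (y : Fin m → ℝ) (hy : Function.Injective y) (z : ℝ)
    (hz : ∀ j, z + y j ≠ 0) :
    ∏ j, (z - y j) / (z + y j) = 1 - ∑ j, (∏ k ∈ Finset.univ.erase j,
      (y j + y k) / (y j - y k)) * (2 * y j / (z + y j)) := by
  classical
  have hinj : Set.InjOn (fun j => -y j) ((Finset.univ : Finset (Fin m)) : Set (Fin m)) :=
    fun i _ j _ h => hy (neg_injective h)
  have hdeg : (Lagrange.nodal Finset.univ y - Lagrange.nodal Finset.univ (fun j => -y j)).degree <
      (Finset.univ : Finset (Fin m)).card := by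
    rw [← Lagrange.degree_nodal (R := ℝ) (s := Finset.univ) (v := y)]
    refine Polynomial.degree_sub_lt_left ?_ ?_ ?_
    · rw [Lagrange.degree_nodal, Lagrange.degree_nodal]
    · exact (Lagrange.nodal_monic).ne_zero
    · rw [(Lagrange.nodal_monic).leadingCoeff, (Lagrange.nodal_monic).leadingCoeff]
  have h := congrArg (Polynomial.eval z) (Lagrange.eq_interpolate hinj hdeg)
  rw [Lagrange.eval_interpolate_not_at_node _ (fun i _ h => hz i (by rw [h]; ring))] at h
  simp only [Polynomial.eval_sub, Lagrange.eval_nodal] at h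
  have hne : ∏ j, (z - -y j) ≠ 0 := Finset.prod_ne_zero_iff.2 fun j _ => by
    rw [sub_neg_eq_add]; exact hz j
  have h2 : ∏ j, (z - y j) / (z + y j) = (∏ j, (z - y j)) / ∏ j, (z - -y j) := by
    simp only [sub_neg_eq_add, Finset.prod_div_distrib]
  rw [h2, div_eq_iff hne, sub_mul, one_mul, eq_sub_iff_add_eq, ← eq_sub_iff_add_eq', ← neg_inj,
    neg_sub, h, ← neg_mul, mul_comm, mul_neg, ← mul_neg, ← Finset.sum_neg_distrib]
  congr 1
  refine Finset.sum_congr rfl fun j _ => ?_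
  have h3 : ∏ k, (-y j - -y k) = 0 := Finset.prod_eq_zero (Finset.mem_univ j) (by ring)
  rw [h3, Lagrange.nodalWeight, ← Finset.mul_prod_erase _ _ (Finset.mem_univ j), sub_zero]
  have h4 : ∏ k ∈ Finset.univ.erase j, (y j + y k) / (y j - y k) =
      (∏ k ∈ Finset.univ.erase j, (-y j - -y k)⁻¹) *
        ∏ k ∈ Finset.univ.erase j, (-y j - y k) := by
    rw [← Finset.prod_mul_distrib]
    refine Finset.prod_congr rfl fun k hk => ?_
    have : y j - y k ≠ 0 := sub_ne_zero.2 fun h => (Finset.ne_of_mem_erase hk) (hy h).symm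
    have h5 : -y j - -y k = -(y j - y k) := by ring
    rw [h5, inv_neg]
    field_simp
    ring
  rw [h4, sub_neg_eq_add]
  field_simp
  ring

/-- The kernel `(x - y) / (x + y)`. -/
noncomputable def schurKernel (x y : ℝ) : ℝ := (x - y) / (x + y)

theorem schurKernel_swap (x y : ℝ) : schurKernel x y = -schurKernel y x := by
  unfold schurKernel
  rw [← neg_div, neg_sub, add_comm]

/-- The partial fraction identity at `z = 0`, where an odd number of factors gives `-1 = 1 - 2 ∑`.
-/
theorem sum_prod_add_div_sub {n : ℕ} (y : Fin (2 * n + 1) → ℝ) (hy : Function.Injective y)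
    (hpos : ∀ j, 0 < y j) :
    ∑ j, ∏ k ∈ Finset.univ.erase j, (y j + y k) / (y j - y k) = 1 := by
  have h := prod_sub_div_add _ y hy 0 (fun j => by rw [zero_add]; exact (hpos j).ne')
  have h1 : ∀ j, (0 - y j) / (0 + y j) = -1 := fun j => by
    have := (hpos j).ne'
    rw [zero_sub, zero_add, neg_div, div_self this]
  have h2 : ∀ j, 2 * y j / (0 + y j) = 2 := fun j => by
    have := (hpos j).ne'
    rw [zero_add]
    field_simp
  simp only [h1, h2, Finset.prod_const, Finset.card_univ, Fintype.card_fin,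
    (odd_two_mul_add_one n).neg_one_pow, ← Finset.sum_mul] at h
  linarith

theorem sum_mul_schurKernel {n : ℕ} (y : Fin (2 * n + 1) → ℝ) (hy : Function.Injective y)
    (hpos : ∀ j, 0 < y j) (z : ℝ) (hz : 0 < z) :
    ∑ j, (∏ k ∈ Finset.univ.erase j, (y j + y k) / (y j - y k)) * schurKernel z (y j) =
      ∏ j, schurKernel z (y j) := by
  have hne : ∀ j, z + y j ≠ 0 := fun j => (add_pos hz (hpos j)).ne'
  have h1 : ∀ j, schurKernel z (y j) = 1 - 2 * y j / (z + y j) := fun j => by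
    have := hne j
    unfold schurKernel
    field_simp
    ring
  have h := prod_sub_div_add _ y hy z hne
  change ∏ j, schurKernel z (y j) = _ at h
  rw [h]
  simp only [h1, mul_sub, mul_one, Finset.sum_sub_distrib, sum_prod_add_div_sub y hy hpos]

theorem upperProd_removeNth_schurKernel {m : ℕ} (y : Fin (m + 1) → ℝ)
    (hy : Function.Injective y) (hpos : ∀ j, 0 < y j) (j : Fin (m + 1)) :
    (-1) ^ (j : ℕ) * upperProd schurKernel m (j.removeNth y) =
      (∏ k ∈ Finset.univ.erase j, (y j + y k) / (y j - y k)) *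
        upperProd schurKernel (m + 1) y := by
  rw [upperProd_eq_removeNth schurKernel_swap m y j]
  have h : (∏ k ∈ Finset.univ.erase j, (y j + y k) / (y j - y k)) *
      ∏ k : Fin m, schurKernel (y j) (y (j.succAbove k)) = 1 := by
    have h1 : Finset.univ.erase j = Finset.univ.map (Fin.succAboveEmb j) := by
      ext i
      simp only [Finset.mem_erase, Finset.mem_univ, and_true, Finset.mem_map, true_and,
        Fin.coe_succAboveEmb]
      exact Fin.exists_succAbove_eq_iff.symm
    rw [h1, Finset.prod_map, ← Finset.prod_mul_distrib]
    refine Finset.prod_eq_one fun k _ => ?_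
    have h2 : y j - y (j.succAbove k) ≠ 0 := sub_ne_zero.2 fun h => Fin.ne_succAbove _ _ (hy h)
    have h3 : y j + y (j.succAbove k) ≠ 0 := (add_pos (hpos _) (hpos _)).ne'
    simp only [Fin.coe_succAboveEmb, schurKernel]
    field_simp
  linear_combination (-(-1) ^ (j : ℕ) * upperProd schurKernel m (j.removeNth y)) * h

/-- Schur's Pfaffian. -/
theorem pf_schurKernel : ∀ (n : ℕ) (x : Fin (2 * n) → ℝ), Function.Injective x →
    (∀ j, 0 < x j) → pf schurKernel (2 * n) x = upperProd schurKernel (2 * n) x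
  | 0, x, _, _ => rfl
  | n + 1, x, hx, hpos => by
    have hy : Function.Injective fun j : Fin (2 * n + 1) => x j.succ :=
      fun i j h => Fin.succ_injective _ (hx h)
    have hyp : ∀ j : Fin (2 * n + 1), 0 < x j.succ := fun j => hpos _
    have h1 := fun j : Fin (2 * n + 1) => pf_schurKernel n (j.removeNth fun j => x j.succ)
      (fun a b h => Fin.succAbove_right_injective (hy h)) (fun a => hyp _)
    change ∑ j : Fin (2 * n + 1), (-1) ^ (j : ℕ) * schurKernel (x 0) (x j.succ) *
      pf schurKernel (2 * n) (j.removeNth fun j => x j.succ) =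
      (∏ j : Fin (2 * n + 1), schurKernel (x 0) (x j.succ)) *
        upperProd schurKernel (2 * n + 1) fun j => x j.succ
    -- By induction the minors are upper products, and relative to the full one they are exactly the
    -- partial fraction coefficients.
    rw [← sum_mul_schurKernel _ hy hyp _ (hpos 0), Finset.sum_mul]
    refine Finset.sum_congr rfl fun j _ => ?_
    have h2 := upperProd_removeNth_schurKernel _ hy hyp j
    rw [h1 j]
    linear_combination schurKernel (x 0) (x j.succ) * h2

/-- The odd counterpart of Schur's Pfaffian: the left side expands a Pfaffian bordered by a row of
ones. -/
theorem sum_pf_schurKernel_removeNth (n : ℕ) (x : Fin (2 * n + 1) → ℝ)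
    (hx : Function.Injective x) (hpos : ∀ j, 0 < x j) :
    ∑ j : Fin (2 * n + 1), (-1) ^ (j : ℕ) * pf schurKernel (2 * n) (j.removeNth x) =
      upperProd schurKernel (2 * n + 1) x := by
  have h1 := fun j : Fin (2 * n + 1) => pf_schurKernel n (j.removeNth x)
      (fun a b h => Fin.succAbove_right_injective (hx h)) (fun a => hpos _)
  have h0 := congrArg (· * upperProd schurKernel (2 * n + 1) x) (sum_prod_add_div_sub x hx hpos)
  simp only [one_mul, Finset.sum_mul] at h0
  rw [← h0]
  refine Finset.sum_congr rfl fun j _ => ?_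
  rw [h1 j, upperProd_removeNth_schurKernel x hx hpos j]

end BToda

/-! ### Integrals over product spaces. -/

namespace BToda

section PiIntegrals

variable {ν : Measure ℝ} [SigmaFinite ν]

theorem measurePreserving_cons (m : ℕ) :
    MeasurePreserving (MeasurableEquiv.piFinSuccAbove (fun _ : Fin (m + 1) => ℝ) 0).symm
      (ν.prod (Measure.pi fun _ : Fin m => ν)) (Measure.pi fun _ : Fin (m + 1) => ν) :=
  (measurePreserving_piFinSuccAbove (fun _ : Fin (m + 1) => ν) 0).symm

theorem piFinSuccAbove_symm_zero {m : ℕ} (q : ℝ × (Fin m → ℝ)) :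
    (MeasurableEquiv.piFinSuccAbove (fun _ : Fin (m + 1) => ℝ) 0).symm q = Fin.cons q.1 q.2 := by
  simp [MeasurableEquiv.piFinSuccAbove_symm_apply, Fin.insertNthEquiv]

theorem integrable_pi_succ {m : ℕ} {F : (Fin (m + 1) → ℝ) → ℝ}
    (h : Integrable (fun q : ℝ × (Fin m → ℝ) => F (Fin.cons q.1 q.2))
      (ν.prod (Measure.pi fun _ : Fin m => ν))) :
    Integrable F (Measure.pi fun _ : Fin (m + 1) => ν) := by
  rw [← (measurePreserving_cons m).integrable_comp_emb (MeasurableEquiv.measurableEmbedding _)]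
  exact h.congr (Filter.Eventually.of_forall fun q => by
    rw [Function.comp_apply, piFinSuccAbove_symm_zero])

theorem integral_pi_succ {m : ℕ} (F : (Fin (m + 1) → ℝ) → ℝ) :
    ∫ x, F x ∂(Measure.pi fun _ : Fin (m + 1) => ν) =
      ∫ q : ℝ × (Fin m → ℝ), F (Fin.cons q.1 q.2) ∂(ν.prod (Measure.pi fun _ : Fin m => ν)) := by
  rw [← (measurePreserving_cons m).integral_comp']
  simp only [piFinSuccAbove_symm_zero]

theorem measurePreserving_cons_cons (m : ℕ) :
    MeasurePreserving ((MeasurableEquiv.prodAssoc.trans ((MeasurableEquiv.refl ℝ).prodCongr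
        (MeasurableEquiv.piFinSuccAbove (fun _ : Fin (m + 1) => ℝ) 0).symm)).trans
        (MeasurableEquiv.piFinSuccAbove (fun _ : Fin (m + 2) => ℝ) 0).symm)
      ((ν.prod ν).prod (Measure.pi fun _ : Fin m => ν))
      (Measure.pi fun _ : Fin (m + 2) => ν) :=
  ((measurePreserving_prodAssoc ν ν _).trans
    ((MeasurePreserving.id ν).prod (measurePreserving_cons m))).trans (measurePreserving_cons (m + 1))

theorem integrable_pi_succ_succ {m : ℕ} {F : (Fin (m + 2) → ℝ) → ℝ}
    (h : Integrable (fun q : (ℝ × ℝ) × (Fin m → ℝ) => F (Fin.cons q.1.1 (Fin.cons q.1.2 q.2)))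
      ((ν.prod ν).prod (Measure.pi fun _ : Fin m => ν))) :
    Integrable F (Measure.pi fun _ : Fin (m + 2) => ν) := by
  rw [← (measurePreserving_cons_cons m).integrable_comp_emb
    (MeasurableEquiv.measurableEmbedding _)]
  refine h.congr (Filter.Eventually.of_forall fun q => ?_)
  simp only [Function.comp_apply, MeasurableEquiv.trans_apply, piFinSuccAbove_symm_zero]
  congr 2
  exact (piFinSuccAbove_symm_zero (q.1.2, q.2)).symm

theorem integral_pi_succ_succ {m : ℕ} (F : (Fin (m + 2) → ℝ) → ℝ) :
    ∫ x, F x ∂(Measure.pi fun _ : Fin (m + 2) => ν) =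
      ∫ q : (ℝ × ℝ) × (Fin m → ℝ), F (Fin.cons q.1.1 (Fin.cons q.1.2 q.2))
        ∂((ν.prod ν).prod (Measure.pi fun _ : Fin m => ν)) := by
  rw [← (measurePreserving_cons_cons m).integral_comp']
  refine integral_congr_ae (Filter.Eventually.of_forall fun q => ?_)
  simp only [MeasurableEquiv.trans_apply, piFinSuccAbove_symm_zero]
  congr 2
  exact piFinSuccAbove_symm_zero (q.1.2, q.2)

theorem measurePreserving_comp_perm {m : ℕ} (σ : Equiv.Perm (Fin m)) :
    MeasurePreserving (MeasurableEquiv.piCongrLeft (fun _ : Fin m => ℝ) σ.symm)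
      (Measure.pi fun _ : Fin m => ν) (Measure.pi fun _ : Fin m => ν) :=
  measurePreserving_piCongrLeft (fun _ : Fin m => ν) σ.symm

theorem piCongrLeft_symm_eq_comp {m : ℕ} (σ : Equiv.Perm (Fin m)) (x : Fin m → ℝ) :
    MeasurableEquiv.piCongrLeft (fun _ : Fin m => ℝ) σ.symm x = x ∘ σ := by
  funext i
  obtain ⟨j, rfl⟩ := σ.symm.surjective i
  rw [MeasurableEquiv.coe_piCongrLeft, Equiv.piCongrLeft_apply_apply]
  simp

theorem integral_comp_perm {m : ℕ} (σ : Equiv.Perm (Fin m)) (F : (Fin m → ℝ) → ℝ) :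
    ∫ x, F (x ∘ σ) ∂(Measure.pi fun _ : Fin m => ν) =
      ∫ x, F x ∂(Measure.pi fun _ : Fin m => ν) := by
  rw [← (measurePreserving_comp_perm σ).integral_comp' F]
  simp only [piCongrLeft_symm_eq_comp]

theorem integrable_comp_perm {m : ℕ} (σ : Equiv.Perm (Fin m)) {F : (Fin m → ℝ) → ℝ}
    (hF : Integrable F (Measure.pi fun _ : Fin m => ν)) :
    Integrable (fun x => F (x ∘ σ)) (Measure.pi fun _ : Fin m => ν) := by
  have := (measurePreserving_comp_perm (ν := ν) σ).integrable_comp_emb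
    (MeasurableEquiv.measurableEmbedding _) |>.2 hF
  exact this.congr (Filter.Eventually.of_forall fun x => by
    rw [Function.comp_apply, piCongrLeft_symm_eq_comp])

/-- The kernels couple disjoint pairs of variables, so Fubini splits off two variables at a time. -/
theorem integral_pairProd {K : ℝ → ℝ → ℝ} {g : ℕ → ℝ → ℝ}
    (hK : ∀ i j, Integrable (fun p : ℝ × ℝ => K p.1 p.2 * (g i p.1 * g j p.2)) (ν.prod ν)) :
    ∀ (n : ℕ) (s : Fin (2 * n) → ℕ),
      Integrable (fun x => pairProd K n x * ∏ k, g (s k) (x k))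
        (Measure.pi fun _ : Fin (2 * n) => ν) ∧
      ∫ x, pairProd K n x * ∏ k, g (s k) (x k) ∂(Measure.pi fun _ : Fin (2 * n) => ν) =
        pairProd (fun i j => ∫ p : ℝ × ℝ, K p.1 p.2 * (g i p.1 * g j p.2) ∂(ν.prod ν)) n s
  | 0, s => by
    simp [pairProd, measureReal_def, isFiniteMeasure_iff]
  | n + 1, s => by
    obtain ⟨ih1, ih2⟩ := integral_pairProd hK n fun i => s i.succ.succ
    have key : ∀ q : (ℝ × ℝ) × (Fin (2 * n) → ℝ),
        pairProd K (n + 1) (Fin.cons q.1.1 (Fin.cons q.1.2 q.2) : Fin (2 * n + 2) → ℝ) *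
          ∏ k : Fin (2 * n + 2), g (s k)
            ((Fin.cons q.1.1 (Fin.cons q.1.2 q.2) : Fin (2 * n + 2) → ℝ) k) =
        (K q.1.1 q.1.2 * (g (s 0) q.1.1 * g (s 1) q.1.2)) *
          (pairProd K n q.2 * ∏ k, g (s k.succ.succ) (q.2 k)) := by
      intro q
      rw [pairProd_succ, Fin.prod_univ_succ, Fin.prod_univ_succ]
      have h1 : (Fin.cons q.1.1 (Fin.cons q.1.2 q.2) : Fin (2 * n + 2) → ℝ) 1 = q.1.2 := rfl
      simp only [Fin.cons_succ, Fin.cons_zero, h1]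
      change _ = K q.1.1 q.1.2 * (g (s 0) q.1.1 * g (s (Fin.succ 0)) q.1.2) * _
      ring
    constructor
    · refine integrable_pi_succ_succ (m := 2 * n) ?_
      refine Integrable.congr ?_ (Filter.Eventually.of_forall fun q => (key q).symm)
      exact Integrable.mul_prod (hK (s 0) (s 1)) ih1
    · refine (integral_pi_succ_succ (m := 2 * n) _).trans ?_
      refine (integral_congr_ae (Filter.Eventually.of_forall key)).trans ?_
      rw [pairProd_succ]
      exact (integral_prod_mul
        (fun p : ℝ × ℝ => K p.1 p.2 * (g (s 0) p.1 * g (s 1) p.2))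
        (fun y : Fin (2 * n) → ℝ => pairProd K n y * ∏ k, g (s k.succ.succ) (y k))).trans
        (by rw [ih2])

theorem integral_pairProd_tail {K : ℝ → ℝ → ℝ} {g : ℕ → ℝ → ℝ}
    (hK : ∀ i j, Integrable (fun p : ℝ × ℝ => K p.1 p.2 * (g i p.1 * g j p.2)) (ν.prod ν))
    (hg : ∀ i, Integrable (g i) ν) (n : ℕ) (s : Fin (2 * n + 1) → ℕ) :
    Integrable (fun x => pairProd K n (Fin.tail x) * ∏ k, g (s k) (x k))
        (Measure.pi fun _ : Fin (2 * n + 1) => ν) ∧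
      ∫ x, pairProd K n (Fin.tail x) * ∏ k, g (s k) (x k)
        ∂(Measure.pi fun _ : Fin (2 * n + 1) => ν) =
        (∫ x, g (s 0) x ∂ν) * pairProd
          (fun i j => ∫ p : ℝ × ℝ, K p.1 p.2 * (g i p.1 * g j p.2) ∂(ν.prod ν)) n
            (Fin.tail s) := by
  obtain ⟨h1, h2⟩ := integral_pairProd hK n (Fin.tail s)
  have key : ∀ q : ℝ × (Fin (2 * n) → ℝ),
      pairProd K n (Fin.tail (Fin.cons q.1 q.2 : Fin (2 * n + 1) → ℝ)) *
        ∏ k : Fin (2 * n + 1), g (s k) ((Fin.cons q.1 q.2 : Fin (2 * n + 1) → ℝ) k) =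
      g (s 0) q.1 * (pairProd K n q.2 * ∏ k, g (Fin.tail s k) (q.2 k)) := by
    intro q
    rw [Fin.prod_univ_succ]
    simp only [Fin.cons_succ, Fin.cons_zero, Fin.tail_cons, Fin.tail]
    ring
  constructor
  · refine integrable_pi_succ ?_
    refine Integrable.congr ?_ (Filter.Eventually.of_forall fun q => (key q).symm)
    exact Integrable.mul_prod (hg (s 0)) h1
  · rw [integral_pi_succ, integral_congr_ae (Filter.Eventually.of_forall key), ← h2]
    exact integral_prod_mul (g (s 0))
      (fun y : Fin (2 * n) → ℝ => pairProd K n y * ∏ k, g (Fin.tail s k) (y k))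

end PiIntegrals

end BToda

/-! ### Nonvanishing by symmetrisation (de Bruijn). -/

namespace BToda

theorem upperProd_mem_sign (A : ℝ → ℝ → ℝ) (hA : ∀ x y, 0 < x → 0 < y → A x y ≤ 0) (m : ℕ) :
    ∃ ε : ℝ, (ε = 1 ∨ ε = -1) ∧
      ∀ x : Fin m → ℝ, (∀ j, 0 < x j) → 0 ≤ ε * upperProd A m x := by
  induction m with
  | zero => exact ⟨1, Or.inl rfl, fun x _ => by simp [upperProd]⟩
  | succ m ih =>
    obtain ⟨ε, hε, h⟩ := ih
    refine ⟨(-1) ^ m * ε, ?_, fun x hx => ?_⟩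
    · rcases neg_one_pow_eq_or ℝ m with h | h <;> rcases hε with h' | h' <;> simp [h, h']
    · have h1 : (-1 : ℝ) ^ m * ∏ j : Fin m, A (x 0) (x j.succ) =
          ∏ j : Fin m, -A (x 0) (x j.succ) := by
        rw [Finset.prod_neg]
        simp
      have h2 : 0 ≤ ∏ j : Fin m, -A (x 0) (x j.succ) :=
        Finset.prod_nonneg fun j _ => neg_nonneg.2 (hA _ _ (hx _) (hx _))
      have h3 := h (Fin.tail x) fun j => hx _
      rw [upperProd]
      have := mul_nonneg h2 h3
      rw [← h1] at this
      linarith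

theorem upperProd_ne_zero {A : ℝ → ℝ → ℝ} (hA : ∀ x y, 0 < x → 0 < y → x ≠ y → A x y ≠ 0)
    {m : ℕ} {x : Fin m → ℝ} (hx : Function.Injective x) (hpos : ∀ j, 0 < x j) :
    upperProd A m x ≠ 0 := by
  rw [upperProd_eq_prod]
  refine Finset.prod_ne_zero_iff.2 fun i _ => Finset.prod_ne_zero_iff.2 fun j hj => ?_
  exact hA _ _ (hpos _) (hpos _) fun h => (Finset.mem_Ioi.1 hj).ne (hx h)

/-- Each diagonal `x_i = x_j` is a proper subspace, hence a null set. -/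
theorem ae_pi_Ioi_injective (m : ℕ) :
    ∀ᵐ x ∂(Measure.pi fun _ : Fin m => volume.restrict (Ioi (0 : ℝ))),
      Function.Injective x ∧ ∀ j, 0 < x j := by
  rw [← Measure.restrict_pi_pi, ← volume_pi]
  refine Filter.Eventually.and (ae_restrict_of_ae ?_) ?_
  · have h : ∀ i j : Fin m, i ≠ j → ∀ᵐ x : Fin m → ℝ, x i ≠ x j := by
      intro i j hij
      let S : Submodule ℝ (Fin m → ℝ) :=
        LinearMap.ker (LinearMap.proj (R := ℝ) (φ := fun _ : Fin m => ℝ) i - LinearMap.proj j)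
      have hS : S ≠ ⊤ := by
        intro h
        have : Pi.single (M := fun _ : Fin m => ℝ) i 1 ∈ S := h ▸ Submodule.mem_top
        simp [S, hij.symm] at this
      have h0 := Measure.addHaar_submodule volume S hS
      rw [ae_iff]
      refine measure_mono_null (fun x hx => ?_) h0
      simp only [ne_eq, not_not, mem_ofPred_eq] at hx
      simp [S, hx]
    have h2 : ∀ᵐ x : Fin m → ℝ, ∀ i j : Fin m, i ≠ j → x i ≠ x j := by
      refine ae_all_iff.2 fun i => ae_all_iff.2 fun j => ?_
      by_cases hij : i = j
      · simp [hij]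
      · filter_upwards [h i j hij] with x hx _ using hx
    filter_upwards [h2] with x hx i j hij
    by_contra hne
    exact hx i j hne hij
  · filter_upwards [ae_restrict_mem (MeasurableSet.univ_pi fun _ => measurableSet_Ioi)] with x hx j
    exact hx j (mem_univ j)

theorem vandermonde_eq_upperProd {m : ℕ} (x : Fin m → ℝ) :
    ∑ τ : Equiv.Perm (Fin m), ((Equiv.Perm.sign τ : ℤ) : ℝ) * ∏ k, x k ^ (τ k : ℕ) =
      upperProd (fun a b => b - a) m x := by
  rw [upperProd_eq_prod, ← Matrix.det_vandermonde, ← Matrix.det_transpose, Matrix.det_apply']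
  rfl

theorem upperProd_comp_perm {A : ℝ → ℝ → ℝ} (hA : ∀ x y, A x y = -A y x) {m : ℕ}
    (σ : Equiv.Perm (Fin m)) (x : Fin m → ℝ) :
    upperProd A m (x ∘ σ) = ((Equiv.Perm.sign σ : ℤ) : ℝ) * upperProd A m x := by
  rw [upperProd_eq_prod, upperProd_eq_prod]
  exact σ.prod_Ioi_comp_eq_sign_mul_prod (f := fun i j => A (x i) (x j)) fun i j => hA _ _

/-- If the signed sum of a product `P` over all orderings of its arguments is a multiple of
`∏_{i<j} (x_i - x_j)/(x_i + x_j)`, the corresponding signed sum of its moments is nonzero. -/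
theorem sum_sign_mul_moment_ne_zero {w : ℝ → ℝ} (hw : ∀ x, 0 < x → 0 ≤ w x)
    (hw0 : ¬ w =ᵐ[volume.restrict (Ioi (0 : ℝ))] 0) {m : ℕ} {P : (Fin m → ℝ) → ℝ}
    {c : (Fin m → ℕ) → ℝ}
    (hint : ∀ s : Fin m → ℕ, Integrable (fun x => P x * ∏ k, (x k ^ s k * w (x k)))
      (Measure.pi fun _ : Fin m => volume.restrict (Ioi (0 : ℝ))))
    (hc : ∀ s : Fin m → ℕ, ∫ x, P x * ∏ k, (x k ^ s k * w (x k))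
      ∂(Measure.pi fun _ : Fin m => volume.restrict (Ioi (0 : ℝ))) = c s)
    {C : ℝ} (hC : C ≠ 0)
    (hP : ∀ x : Fin m → ℝ, Function.Injective x → (∀ j, 0 < x j) →
      ∑ σ : Equiv.Perm (Fin m), ((Equiv.Perm.sign σ : ℤ) : ℝ) * P (x ∘ σ) =
        C * upperProd schurKernel m x) :
    ∑ τ : Equiv.Perm (Fin m), ((Equiv.Perm.sign τ : ℤ) : ℝ) * c (fun k => τ k) ≠ 0 := by
  set π := Measure.pi fun _ : Fin m => volume.restrict (Ioi (0 : ℝ)) with hπ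
  set V : (Fin m → ℝ) → ℝ := upperProd (fun a b => b - a) m with hV
  set Φ : (Fin m → ℝ) → ℝ := fun x => V x * P x * ∏ k, w (x k) with hΦ
  have hsum : ∀ x, Φ x = ∑ τ : Equiv.Perm (Fin m), ((Equiv.Perm.sign τ : ℤ) : ℝ) *
      (P x * ∏ k, (x k ^ (τ k : ℕ) * w (x k))) := by
    intro x
    simp only [hΦ, hV, ← vandermonde_eq_upperProd, Finset.prod_mul_distrib, Finset.sum_mul]
    exact Finset.sum_congr rfl fun τ _ => by ring
  have hΦi : Integrable Φ π := by
    rw [funext hsum]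
    exact integrable_finsetSum _ fun τ _ => (hint _).const_mul _
  -- Summing the monomials with signs under the integral produces the Vandermonde factor `V`.
  have hJ : ∑ τ : Equiv.Perm (Fin m), ((Equiv.Perm.sign τ : ℤ) : ℝ) * c (fun k => τ k) =
      ∫ x, Φ x ∂π := by
    rw [integral_congr_ae (Filter.Eventually.of_forall hsum),
      integral_finsetSum _ fun τ _ => (hint _).const_mul _]
    exact Finset.sum_congr rfl fun τ _ => by rw [integral_const_mul, hc]
  rw [hJ]
  intro h0
  set Ψ : (Fin m → ℝ) → ℝ := fun x =>
    upperProd (fun a b => (b - a) * schurKernel a b) m x * ∏ k, w (x k) with hΨ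
  -- `V` is antisymmetric and the weights are symmetric, so symmetrising `Φ` means taking the signed
  -- sum of `P`, known from `hP`. As `C ≠ 0`, this also makes `Ψ` integrable with integral zero.
  have hsym : ∀ᵐ x ∂π, ∑ σ : Equiv.Perm (Fin m), Φ (x ∘ σ) = C * Ψ x := by
    filter_upwards [ae_pi_Ioi_injective m] with x hx
    have h1 : ∀ σ : Equiv.Perm (Fin m), Φ (x ∘ σ) =
        (V x * ∏ k, w (x k)) * (((Equiv.Perm.sign σ : ℤ) : ℝ) * P (x ∘ σ)) := by
      intro σ
      have h2 : ∏ k, w ((x ∘ σ) k) = ∏ k, w (x k) := Equiv.prod_comp σ fun k => w (x k)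
      simp only [hΦ]
      rw [h2, hV, upperProd_comp_perm fun a b => (neg_sub a b).symm]
      ring
    rw [Finset.sum_congr rfl fun σ _ => h1 σ, ← Finset.mul_sum, hP x hx.1 hx.2]
    simp only [hΨ, ← upperProd_mul]
    ring
  have hΨi : Integrable Ψ π := by
    have h1 : Integrable (fun x => ∑ σ : Equiv.Perm (Fin m), Φ (x ∘ σ)) π :=
      integrable_finsetSum _ fun σ _ => integrable_comp_perm σ hΦi
    refine ((h1.congr hsym).const_mul C⁻¹).congr (Filter.Eventually.of_forall fun x => ?_)
    exact inv_mul_cancel_left₀ hC _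
  have hΨ0 : ∫ x, Ψ x ∂π = 0 := by
    have h1 : ∫ x, ∑ σ : Equiv.Perm (Fin m), Φ (x ∘ σ) ∂π = 0 := by
      rw [integral_finsetSum _ fun σ _ => integrable_comp_perm σ hΦi]
      exact Finset.sum_eq_zero fun σ _ => (integral_comp_perm σ Φ).trans h0
    rw [integral_congr_ae hsym, integral_const_mul] at h1
    exact (mul_eq_zero.1 h1).resolve_left hC
  obtain ⟨ε, hε, hsgn⟩ := upperProd_mem_sign (fun a b => (b - a) * schurKernel a b)
    (fun x y hx hy => by
      unfold schurKernel
      have : (y - x) * ((x - y) / (x + y)) = -((x - y) ^ 2 / (x + y)) := by ring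
      rw [this]
      exact neg_nonpos.2 (div_nonneg (sq_nonneg _) (add_pos hx hy).le)) m
  have hε0 : ε ≠ 0 := by rcases hε with h | h <;> simp [h]
  have hnn : 0 ≤ᵐ[π] fun x => ε * Ψ x := by
    filter_upwards [ae_pi_Ioi_injective m] with x hx
    have := mul_nonneg (hsgn x hx.2) 
      (Finset.prod_nonneg fun k (_ : k ∈ Finset.univ) => hw (x k) (hx.2 k))
    simp only [Pi.zero_apply, hΨ, ← mul_assoc]
    exact this
  have hzero := (integral_eq_zero_iff_of_nonneg_ae hnn (hΨi.const_mul ε)).1 (by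
    rw [integral_const_mul, hΨ0, mul_zero])
  -- `Ψ` has constant sign and integral zero, so it vanishes almost everywhere. Off the diagonals
  -- its first factor is nonzero, so the cube over `{w ≠ 0}` is null, which forces `w = 0` almost
  -- everywhere.
  have hnull : π (univ.pi fun _ => {x : ℝ | w x ≠ 0}) = 0 := by
    rw [← compl_compl (univ.pi fun _ => {x : ℝ | w x ≠ 0}), ← mem_ae_iff]
    filter_upwards [hzero, ae_pi_Ioi_injective m] with x hx hpos hmem
    rw [Pi.zero_apply] at hx
    have h1 := (mul_eq_zero.1 hx).resolve_left hε0
    rcases mul_eq_zero.1 h1 with h2 | h2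
    · refine upperProd_ne_zero (fun a b ha hb hab => ?_) hpos.1 hpos.2 h2
      exact mul_ne_zero (sub_ne_zero.2 hab.symm)
        (div_ne_zero (sub_ne_zero.2 hab) (add_pos ha hb).ne')
    · exact Finset.prod_ne_zero_iff.2 (fun k _ => hmem k (mem_univ k)) h2
  rw [hπ, Measure.pi_pi] at hnull
  refine Finset.prod_ne_zero_iff.2 (fun k _ => ?_) hnull
  exact fun h => hw0 (by rwa [Filter.EventuallyEq, ae_iff])

end BToda

/-! ### Nonvanishing of the tau-functions and the Toda lattice. -/

namespace BToda

variable {ρ : ℝ → ℝ} {t : ℝ}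

section Nonvanishing

variable {w : ℝ → ℝ} {M : ℕ → ℕ → ℝ} {B : ℕ → ℝ}

theorem pairSum_moment_ne_zero (hw : ∀ x, 0 < x → 0 ≤ w x)
    (hw0 : ¬ w =ᵐ[volume.restrict (Ioi (0 : ℝ))] 0)
    (hK : ∀ i j, Integrable
      (fun p : ℝ × ℝ => schurKernel p.1 p.2 * (p.1 ^ i * w p.1 * (p.2 ^ j * w p.2)))
      ((volume.restrict (Ioi (0 : ℝ))).prod (volume.restrict (Ioi (0 : ℝ)))))
    (hM : ∀ i j, M i j =
      ∫ p : ℝ × ℝ, schurKernel p.1 p.2 * (p.1 ^ i * w p.1 * (p.2 ^ j * w p.2))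
        ∂((volume.restrict (Ioi (0 : ℝ))).prod (volume.restrict (Ioi (0 : ℝ))))) (n : ℕ) :
    ∑ τ : Equiv.Perm (Fin (2 * n)), ((Equiv.Perm.sign τ : ℤ) : ℝ) *
      pairProd M n (fun k => (τ k : ℕ)) ≠ 0 := by
  have hM' := funext fun i => funext (hM i)
  have hC : (2 ^ n * (n.factorial : ℝ)) ≠ 0 := by positivity
  have hI := integral_pairProd (g := fun i x => x ^ i * w x) hK n
  refine sum_sign_mul_moment_ne_zero hw hw0 (P := pairProd schurKernel n) (c := pairProd M n)
    (fun s => (hI s).1) (fun s => ?_) hC (fun x hx hpos => ?_)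
  · rw [hM']
    exact (hI s).2
  · rw [← pf_schurKernel n x hx hpos, ← pairSum_eq_pf schurKernel_swap, pairSum]

/-- In the odd case the first variable is unpaired and integrates to a single moment `B`; the
kernels couple the others. -/
theorem sum_moment_mul_pairProd_ne_zero (hw : ∀ x, 0 < x → 0 ≤ w x)
    (hw0 : ¬ w =ᵐ[volume.restrict (Ioi (0 : ℝ))] 0)
    (hg : ∀ i : ℕ, Integrable (fun x => x ^ i * w x) (volume.restrict (Ioi (0 : ℝ))))
    (hK : ∀ i j, Integrable
      (fun p : ℝ × ℝ => schurKernel p.1 p.2 * (p.1 ^ i * w p.1 * (p.2 ^ j * w p.2)))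
      ((volume.restrict (Ioi (0 : ℝ))).prod (volume.restrict (Ioi (0 : ℝ)))))
    (hB : ∀ i, B i = ∫ x : ℝ in Ioi 0, x ^ i * w x)
    (hM : ∀ i j, M i j =
      ∫ p : ℝ × ℝ, schurKernel p.1 p.2 * (p.1 ^ i * w p.1 * (p.2 ^ j * w p.2))
        ∂((volume.restrict (Ioi (0 : ℝ))).prod (volume.restrict (Ioi (0 : ℝ))))) (n : ℕ) :
    ∑ τ : Equiv.Perm (Fin (2 * n + 1)), ((Equiv.Perm.sign τ : ℤ) : ℝ) *
      (B (τ 0) * pairProd M n (fun k => (τ k.succ : ℕ))) ≠ 0 := by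
  have hM' := funext fun i => funext (hM i)
  have hC : (2 ^ n * (n.factorial : ℝ)) ≠ 0 := by positivity
  have hI := integral_pairProd_tail (g := fun i x => x ^ i * w x) hK hg n
  refine sum_sign_mul_moment_ne_zero hw hw0 (P := fun x => pairProd schurKernel n (Fin.tail x))
    (c := fun s => B (s 0) * pairProd M n (Fin.tail s))
    (fun s => (hI s).1) (fun s => ?_) hC (fun x hx hpos => ?_)
  · rw [hM', hB]
    exact (hI s).2
  · rw [← sum_pf_schurKernel_removeNth n x hx hpos, Finset.mul_sum]
    refine (sum_perm_eq_sum_cons fun s => pairProd schurKernel n (Fin.tail (x ∘ s))).trans ?_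
    refine Finset.sum_congr rfl fun j _ => ?_
    rw [mul_left_comm, ← pairSum_eq_pf schurKernel_swap, pairSum]
    congr 1

end Nonvanishing

theorem pairSum_initLabels (ρ : ℝ → ℝ) (n : ℕ) (t : ℝ) :
    ∑ τ : Equiv.Perm (Fin (2 * n)), ((Equiv.Perm.sign τ : ℤ) : ℝ) *
      pairProd (fun i j => mu ρ i j t) n (fun k => (τ k : ℕ)) =
      2 ^ n * (n.factorial : ℝ) * tau ρ (2 * n) t := by
  rw [tau_even_eq_pf, ← pairSum_eq_pf (entry_swap ρ t), pairSum]
  refine Finset.sum_congr rfl fun τ _ => ?_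
  congr 1

theorem sum_beta_mul_pairProd (ρ : ℝ → ℝ) (n : ℕ) (t : ℝ) :
    ∑ τ : Equiv.Perm (Fin (2 * n + 1)), ((Equiv.Perm.sign τ : ℤ) : ℝ) *
      (beta ρ (τ 0) t * pairProd (fun i j => mu ρ i j t) n (fun k => (τ k.succ : ℕ))) =
      2 ^ n * (n.factorial : ℝ) * tau ρ (2 * n + 1) t := by
  rw [tau_odd_eq_pf, pf_cons, Finset.mul_sum]
  refine (sum_perm_eq_sum_cons fun s => beta ρ (s 0 : ℕ) t *
    pairProd (fun i j => mu ρ i j t) n (fun k => (s k.succ : ℕ))).trans ?_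
  refine Finset.sum_congr rfl fun j _ => ?_
  rw [mul_left_comm, ← pairSum_eq_pf (entry_swap ρ t), pairSum, Finset.mul_sum, Finset.mul_sum]
  refine Finset.sum_congr rfl fun e _ => ?_
  have h1 : pairProd (entry ρ t) n (j.removeNth (initLabels (2 * n + 1)) ∘ e) =
    pairProd (fun i j => mu ρ i j t) n (fun k => (j.succAbove (e k) : ℕ)) := rfl
  have h2 : entry ρ t .d0 (initLabels (2 * n + 1) j) = beta ρ j t := rfl
  rw [h1, h2]
  simp only [Fin.cons_zero, Fin.cons_succ]
  ring

theorem tau_ne_zero (hρ : ∀ x : ℝ, 0 < x → 0 ≤ ρ x)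
    (hρ0 : ¬ ρ =ᵐ[volume.restrict (Ioi (0 : ℝ))] 0)
    (h : ∀ i, IntegrableOn (weighted ρ t i) (Ioi 0)) (m : ℕ) : tau ρ m t ≠ 0 := by
  have hw : ∀ x, 0 < x → 0 ≤ Real.exp (t * x) * ρ x := fun x hx =>
    mul_nonneg (Real.exp_pos _).le (hρ x hx)
  have hw0 : ¬ (fun x => Real.exp (t * x) * ρ x) =ᵐ[volume.restrict (Ioi (0 : ℝ))] 0 := by
    intro h0
    apply hρ0
    filter_upwards [h0] with x hx
    exact (mul_eq_zero.1 hx).resolve_left (Real.exp_ne_zero _)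
  have hg : ∀ i, Integrable (fun x : ℝ => x ^ i * (Real.exp (t * x) * ρ x))
      (volume.restrict (Ioi 0)) := fun i =>
    (h i).congr (Filter.Eventually.of_forall fun x => mul_assoc _ _ _)
  have hKeq : ∀ i j, muIntegrand ρ i j t = fun p : ℝ × ℝ => schurKernel p.1 p.2 *
      (p.1 ^ i * (Real.exp (t * p.1) * ρ p.1) * (p.2 ^ j * (Real.exp (t * p.2) * ρ p.2))) := by
    intro i j
    funext p
    rw [muIntegrand_eq]
    simp only [weighted, schurKernel, mul_assoc]
  have hK : ∀ i j, Integrable (fun p : ℝ × ℝ => schurKernel p.1 p.2 *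
      (p.1 ^ i * (Real.exp (t * p.1) * ρ p.1) * (p.2 ^ j * (Real.exp (t * p.2) * ρ p.2))))
      ((volume.restrict (Ioi (0 : ℝ))).prod (volume.restrict (Ioi (0 : ℝ)))) := by
    intro i j
    rw [← hKeq, ← restrict_prod_Ioi]
    exact integrableOn_muIntegrand h i j
  have hM : ∀ i j, mu ρ i j t = ∫ p : ℝ × ℝ, schurKernel p.1 p.2 *
      (p.1 ^ i * (Real.exp (t * p.1) * ρ p.1) * (p.2 ^ j * (Real.exp (t * p.2) * ρ p.2)))
      ∂((volume.restrict (Ioi (0 : ℝ))).prod (volume.restrict (Ioi (0 : ℝ)))) := by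
    intro i j
    rw [← hKeq, ← restrict_prod_Ioi, mu]
  have hB : ∀ i, beta ρ i t = ∫ x : ℝ in Ioi 0, x ^ i * (Real.exp (t * x) * ρ x) := by
    intro i
    simp only [← mul_assoc, beta]
  rcases Nat.even_or_odd' m with ⟨n, rfl | rfl⟩
  · have key := pairSum_moment_ne_zero hw hw0 hK hM n
    rw [pairSum_initLabels] at key
    exact right_ne_zero_of_mul key
  · have key := sum_moment_mul_pairProd_ne_zero hw hw0 hg hK hB hM n
    rw [sum_beta_mul_pairProd] at key
    exact right_ne_zero_of_mul key

theorem b_eq_div (h : MomentFlow ρ t) {n : ℕ} (hne : tau ρ n t ≠ 0) :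
    b ρ n t = deriv (tau ρ n) t / tau ρ n t :=
  deriv.log (differentiableAt_tau h n) hne

theorem hasDerivAt_u (h : MomentFlow ρ t) (hne : ∀ n, tau ρ n t ≠ 0) (k : ℕ) :
    HasDerivAt (u ρ (k + 1))
      (u ρ (k + 1) t * (b ρ (k + 1 + 1) t - 2 * b ρ (k + 1) t + b ρ (k + 1 - 1) t)) t := by
  have hd := fun n => (differentiableAt_tau h n).hasDerivAt
  have h1 := ((hd (k + 2)).mul (hd k)).div ((hd (k + 1)).pow 2) (pow_ne_zero 2 (hne (k + 1)))
  refine HasDerivAt.congr_deriv (f := u ρ (k + 1)) h1 ?_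
  have h0 := hne k
  have h2 := hne (k + 1)
  have h3 := hne (k + 2)
  rw [b_eq_div h (hne _), b_eq_div h (hne _), b_eq_div h (hne _), Nat.add_sub_cancel]
  simp only [u, Pi.mul_apply, Pi.pow_apply]
  field_simp
  ring

theorem hasDerivAt_b (h : ∀ᶠ s in nhds t, MomentFlow ρ s)
    (hne : ∀ᶠ s in nhds t, ∀ n, tau ρ n s ≠ 0) (k : ℕ) :
    HasDerivAt (b ρ (k + 1)) (u ρ (k + 1) t * (b ρ (k + 1 - 1) t - b ρ (k + 1 + 1) t)) t := by
  have h0 := h.self_of_nhds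
  have hn := hne.self_of_nhds
  have heq : b ρ (k + 1) =ᶠ[nhds t] fun s => deriv (tau ρ (k + 1)) s / tau ρ (k + 1) s := by
    filter_upwards [h, hne] with s hs hs' using b_eq_div hs (hs' _)
  have h1 := (differentiableAt_deriv_tau h (k + 1)).hasDerivAt.div
    (differentiableAt_tau h0 (k + 1)).hasDerivAt (hn _)
  refine (h1.congr_of_eventuallyEq heq).congr_deriv ?_
  -- The quotient rule has produced `(τ'' τ - τ'²)/τ²`, whose numerator is the left side of the
  -- bilinear equation.
  have hb := tau_bilinear h (Nat.le_add_left 1 k)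
  rw [← sq, hb, b_eq_div h0 (hn _), b_eq_div h0 (hn _), Nat.add_sub_cancel]
  have h2 := hn k
  have h3 := hn (k + 1)
  have h4 := hn (k + 2)
  simp only [u]
  field_simp

end BToda

/-! ### The main theorem. -/

theorem mainTheorem1 (ρ : ℝ → ℝ) (I : Set ℝ) (hI : IsOpen I)
    -- `ρ` is a nonnegative weight on `ℝ₊`, not almost everywhere zero
    (hρ : ∀ x : ℝ, 0 < x → 0 ≤ ρ x)
    (hρ0 : ¬ ρ =ᵐ[volume.restrict (Ioi (0 : ℝ))] 0)
    -- the deformed weight has finite moments at all times in `I`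
    (hmom : ∀ t ∈ I, ∀ i : ℕ,
      IntegrableOn (fun x : ℝ => x ^ i * Real.exp (t * x) * ρ x) (Ioi (0 : ℝ))) :
    -- explicit form of the tau-functions
    (∀ (n : ℕ) (t : ℝ), BToda.tau ρ (2 * n) t = BToda.Pf ρ t (BToda.evenLabels n) ∧
      BToda.tau ρ (2 * n + 1) t = BToda.Pf ρ t (BToda.oddLabels n)) ∧
    -- the Pfaffian entries and their evolution
    (∀ t ∈ I, ∀ i j : ℕ,
      IntegrableOn (BToda.muIntegrand ρ i j t) (Ioi (0 : ℝ) ×ˢ Ioi (0 : ℝ)) ∧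
      BToda.entry ρ t (.num i) (.num j) = BToda.mu ρ i j t ∧
      BToda.entry ρ t .d0 (.num i) = BToda.beta ρ i t ∧
      BToda.entry ρ t .d0 .d1 = 0 ∧
      HasDerivAt (fun s => BToda.entry ρ s .d0 (.num i))
        (BToda.entry ρ t .d0 (.num (i + 1))) t ∧
      BToda.entry ρ t .d0 (.num (i + 1)) = BToda.entry ρ t .d1 (.num i) ∧
      HasDerivAt (fun s => BToda.entry ρ s (.num i) (.num j))
        (BToda.entry ρ t (.num (i + 1)) (.num j) + BToda.entry ρ t (.num i) (.num (j + 1))) t ∧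
      BToda.entry ρ t (.num (i + 1)) (.num j) + BToda.entry ρ t (.num i) (.num (j + 1)) =
        BToda.Pf ρ t (n := 2) ![.d0, .d1, .num i, .num j]) ∧
    -- the tau-functions do not vanish and are twice differentiable
    (∀ t ∈ I, ∀ n : ℕ, BToda.tau ρ n t ≠ 0 ∧ DifferentiableAt ℝ (BToda.tau ρ n) t ∧
      DifferentiableAt ℝ (deriv (BToda.tau ρ n)) t) ∧
    -- the bilinear equation
    (∀ t ∈ I, ∀ n : ℕ, 1 ≤ n →
      deriv (deriv (BToda.tau ρ n)) t * BToda.tau ρ n t - deriv (BToda.tau ρ n) t ^ 2 =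
        deriv (BToda.tau ρ (n - 1)) t * BToda.tau ρ (n + 1) t -
          deriv (BToda.tau ρ (n + 1)) t * BToda.tau ρ (n - 1) t) ∧
    -- the 1+1 Toda lattice of BKP type
    (∀ t ∈ I, ∀ n : ℕ, 1 ≤ n →
      HasDerivAt (BToda.u ρ n)
        (BToda.u ρ n t * (BToda.b ρ (n + 1) t - 2 * BToda.b ρ n t + BToda.b ρ (n - 1) t)) t ∧
      HasDerivAt (BToda.b ρ n)
        (BToda.u ρ n t * (BToda.b ρ (n - 1) t - BToda.b ρ (n + 1) t)) t) := by
  have hw : ∀ t ∈ I, ∀ i, IntegrableOn (BToda.weighted ρ t i) (Ioi 0) := hmom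
  have hflow : ∀ t ∈ I, BToda.MomentFlow ρ t := fun t ht => BToda.momentFlow hI hw ht
  have hev : ∀ t ∈ I, ∀ᶠ s in nhds t, BToda.MomentFlow ρ s := fun t ht =>
    Filter.mem_of_superset (hI.mem_nhds ht) hflow
  have hne : ∀ t ∈ I, ∀ n, BToda.tau ρ n t ≠ 0 := fun t ht n =>
    BToda.tau_ne_zero hρ hρ0 (hw t ht) n
  refine ⟨fun n t => ⟨BToda.tau_two_mul ρ n t, BToda.tau_two_mul_add_one ρ n t⟩,
    fun t ht i j => ⟨BToda.integrableOn_muIntegrand (hw t ht) i j, rfl, rfl, rfl,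
      (hflow t ht).beta i, rfl, (hflow t ht).mu i j, ?_⟩,
    fun t ht n => ⟨hne t ht n, BToda.differentiableAt_tau (hflow t ht) n,
      BToda.differentiableAt_deriv_tau (hev t ht) n⟩,
    fun t ht n hn => BToda.tau_bilinear (hev t ht) hn,
    fun t ht n hn => ?_⟩
  · rw [BToda.Pf_eq_pf]
    -- Both sides are derivatives of `μ_{i,j} = Pf(i, j)`, so uniqueness of the derivative
    -- identifies them.
    have h := (BToda.hasDerivAt_pf_nums (hflow t ht) 2 ![i, j]).unique
      (((hflow t ht).mu i j).congr_of_eventuallyEq (Filter.Eventually.of_forall fun s => by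
        simp [BToda.pf, BToda.nums, BToda.entry]))
    refine h.symm.trans ?_
    change _ = BToda.pf (BToda.entry ρ t) 4 _
    congr 1
    funext k
    fin_cases k <;> rfl
  · obtain ⟨k, rfl⟩ : ∃ k, n = k + 1 := ⟨n - 1, by omega⟩
    have hne' : ∀ᶠ s in nhds t, ∀ n, BToda.tau ρ n s ≠ 0 :=
      Filter.mem_of_superset (hI.mem_nhds ht) hne
    exact ⟨BToda.hasDerivAt_u (hflow t ht) (hne t ht) k,
      BToda.hasDerivAt_b (hev t ht) hne' k⟩
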